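/- Let $(E,h)$ be a Hermitian holomorphic vector bundle of rank $r$ over a complex manifold $X$ of dimension $n$. With respect to a local holomorphic frame $\{e_i\}$ and local holomorphic coordinates $\{z^\alpha\}$, let $R=(R^j_i)$, $R^j_i=R^j_{i\alpha\bar\beta}\,dz^\alpha\wedge d\bar z^\beta$ ($j$ row, $i$ column), be the Chern curvature matrix, i.e. $R=\bar\partial\theta$ with $\theta^\top=\partial h\cdot h^{-1}$, $h=(h_{i\bar k})$, $h_{i\bar k}=h(e_i,e_k)$, and put $R_{i\bar j\alpha\bar\beta}=R^k_{i\alpha\bar\beta}h_{k\bar j}$ (summation convention). $(E,h)$ is called *strongly decomposably non-negative* (resp. *positive*) *of type I* if for every $x\in X$ there is a decomposition $T^{1,0}_xX=U_x\oplus V_x$ into complex subspaces such that, at $x$, $$R_{i\bar j\alpha\bar\beta}u^{i\alpha}\overline{u^{j\beta}}\ge 0\ (\text{resp. }>0),\qquad R_{i\bar j\alpha\bar\beta}u^{i\alpha}\overline{v'^{j\beta}}=0,\qquad R_{i\bar j\alpha\bar\beta}v^{\bar j\alpha}\overline{v^{\bar i\beta}}\ge 0\ (\text{resp. }>0)$$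 for all non-zero $u=u^{i\alpha}e_i\otimes\partial_\alpha\in E_x\otimes U_x$, $v'=v'^{j\beta}e_j\otimes\partial_\beta\in E_x\otimes V_x$ and $v=v^{\bar j\alpha}\bar e_j\otimes\partial_\alpha\in\overline{E}_x\otimes V_x$. For a point $x$ and a unitary frame of $E_x$ consider, for some $N_1,N_2\in\mathbb N$, an $r\times N_2$ matrix $B=(B_{ip})$ of $(0,1)$-forms at $x$ and an $r\times N_1$ matrix $A=(A_{ip})$ of $(1,0)$-forms at $x$ such that the Chern curvature matrix at $x$ with respect to this frame satisfies $$R=-B\wedge\overline B^{\top}+A\wedge\overline A^{\top}\quad(1),\qquad \mathrm{span}_{\mathbb C}\{\overline{B_{ip}}\}\cap\mathrm{span}_{\mathbb C}\{A_{ip}\}=\{0\}\quad(2).$$ Writing $B_{ip}=B_{ip\bar\alpha}d\bar z^\alpha$ and $A_{jp}=A_{jp\alpha}dz^\alpha$, let $\mathbf B=(B_{ip\bar\alpha})_{p,\,i\alpha}$ and $\mathbf A=(A_{jp\alpha})_{p,\,j\alpha}$, matrices with rows indexed by $p$ and columns indexed by $(i,\alpha)$, resp. $(j,\alpha)$, $1\le\alpha\le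 n$. **Theorem.** 1. $(E,h)$ is strongly decomposably non-negative of type I if and only if at each $x\in X$, with respect to some unitary frame of $E_x$, there are $A$, $B$ satisfying (1) and (2); equivalently, if and only if this holds at each $x\in X$ with respect to every unitary frame of $E_x$. 2. $(E,h)$ is strongly decomposably positive of type I if and only if at each $x\in X$, with respect to some unitary frame of $E_x$, there are $A$, $B$ satisfying (1) and (2) and a decomposition $T^{1,0}_xX=U_x\oplus V_x$ with $$\mathrm{rank}(\mathbf A)=r\dim V_x,\qquad \mathrm{rank}(\mathbf B)=r\dim U_x;$$ equivalently, if and only if this holds at each $x\in X$ with respect to every unitary frame of $E_x$, where in addition the decomposition can be chosen so that the $\overline{B_{ip}}$ lie in $U_x^*$ (they vanish on $V_x$) and the $A_{ip}$ lie in $V_x^*$ (they vanish on $U_x$). -/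

import Mathlib

open scoped Manifold Bundle ContDiff ComplexOrder
open Bundle

noncomputable section

namespace ChernCriterion

/-- The model space `ℂⁿ` with its coordinates `z¹, …, zⁿ`. -/
abbrev Cn (n : ℕ) : Type := EuclideanSpace ℂ (Fin n)

/-- The holomorphic tangent space `T^{1,0}_x X` of a complex manifold modelled on `ℂⁿ`. As a real
vector space it is also the real tangent space. Mathlib identifies it with `ℂⁿ` through the
preferred holomorphic chart at `x`. -/
abbrev HolTangent (n : ℕ) {X : Type*} [TopologicalSpace X] [ChartedSpace (Cn n) X] (x : X) :
    Type :=
  TangentSpace 𝓘(ℂ, Cn n) x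

section Wirtinger

variable {n : ℕ}

/-- The coordinate vector `∂/∂z^α` of `ℂⁿ`. -/
def stdVec (α : Fin n) : Cn n := EuclideanSpace.single α 1

/-- The Wirtinger derivative `∂f/∂z^α = (∂f/∂x^α - i ∂f/∂y^α) / 2`. -/
def wirt (α : Fin n) (f : Cn n → ℂ) (z : Cn n) : ℂ :=
  (fderiv ℝ f z (stdVec α) - Complex.I * fderiv ℝ f z (Complex.I • stdVec α)) / 2

/-- The conjugate Wirtinger derivative `∂f/∂z̄^β = (∂f/∂x^β + i ∂f/∂y^β) / 2`. -/
def wirtBar (β : Fin n) (f : Cn n → ℂ) (z : Cn n) : ℂ :=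
  (fderiv ℝ f z (stdVec β) + Complex.I * fderiv ℝ f z (Complex.I • stdVec β)) / 2

/-- The matrix `θ_α` in `θ = θ_α dz^α`, for `θᵀ = ∂h · h⁻¹`: the Chern connection form of the
metric matrix `H = (h_{i k̄})`, as a function of the coordinates. The entry `(j, i)` is `θ^j_{i α}`
(`j` row, `i` column). -/
def connectionForm {r : ℕ} (H : Cn n → Matrix (Fin r) (Fin r) ℂ) (α : Fin n) (z : Cn n) :
    Matrix (Fin r) (Fin r) ℂ :=
  (Matrix.of (fun i k => wirt α (fun w => H w i k) z) * (H z)⁻¹).transpose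

/-- The coefficients `R^j_{i α β̄}` (`j` row, `i` column) of the Chern curvature matrix
`R = ∂̄θ = R_{α β̄} dz^α ∧ dz̄^β`, that is `R_{α β̄} = - ∂θ_α/∂z̄^β`. -/
def curvatureMatrix {r : ℕ} (H : Cn n → Matrix (Fin r) (Fin r) ℂ) (α β : Fin n) (z : Cn n) :
    Matrix (Fin r) (Fin r) ℂ :=
  Matrix.of fun j i => - wirtBar β (fun w => connectionForm H α w j i) z

end Wirtinger

section Bundle

/-- A smooth Hermitian metric on a holomorphic vector bundle `E` of rank `r`: a positive definite
Hermitian form on every fibre, linear in the first variable and conjugate linear in the second,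
whose coefficients in every holomorphic trivialization are smooth functions in the real sense. -/
structure HermitianMetric (n r : ℕ) {X : Type*} [TopologicalSpace X] [ChartedSpace (Cn n) X]
    (E : X → Type*) [TopologicalSpace (TotalSpace (Cn r) E)]
    [∀ x, AddCommGroup (E x)] [∀ x, Module ℂ (E x)] [∀ x, TopologicalSpace (E x)]
    [FiberBundle (Cn r) E] [VectorBundle ℂ (Cn r) E] where
  /-- the Hermitian form on the fibre at `x` -/
  form (x : X) : E x →ₗ[ℂ] E x →ₗ⋆[ℂ] ℂ
  conj_symm (x : X) (v w : E x) : starRingEnd ℂ (form x v w) = form x w v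
  pos (x : X) (v : E x) : v ≠ 0 → 0 < form x v v
  smooth (e : Trivialization (Cn r) (Bundle.TotalSpace.proj : TotalSpace (Cn r) E → X))
    [MemTrivializationAtlas e] (v w : Cn r) :
    ContMDiffOn 𝓘(ℝ, Cn n) 𝓘(ℝ, ℂ) ∞ (fun y => form y (e.symm y v) (e.symm y w)) e.baseSet

variable {n r : ℕ} {X : Type*} [TopologicalSpace X] [ChartedSpace (Cn n) X]
  {E : X → Type*} [TopologicalSpace (TotalSpace (Cn r) E)]
  [∀ x, AddCommGroup (E x)] [∀ x, Module ℂ (E x)] [∀ x, TopologicalSpace (E x)]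
  [FiberBundle (Cn r) E] [VectorBundle ℂ (Cn r) E]

/-- The local holomorphic frame `e_1, …, e_r` of `E` around `x` that is given by the preferred
holomorphic trivialization at `x`. -/
def localFrame (E : X → Type*) [TopologicalSpace (TotalSpace (Cn r) E)]
    [∀ x, AddCommGroup (E x)] [∀ x, Module ℂ (E x)] [∀ x, TopologicalSpace (E x)]
    [FiberBundle (Cn r) E] [VectorBundle ℂ (Cn r) E] (x : X) (i : Fin r) (y : X) : E y :=
  (trivializationAt (Cn r) E x).symm y (stdVec i)

/-- The values at `x` of the local holomorphic frame around `x`, as a basis of `E x`. -/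
def frameBasis (E : X → Type*) [TopologicalSpace (TotalSpace (Cn r) E)]
    [∀ x, AddCommGroup (E x)] [∀ x, Module ℂ (E x)] [∀ x, TopologicalSpace (E x)]
    [FiberBundle (Cn r) E] [VectorBundle ℂ (Cn r) E] (x : X) : Module.Basis (Fin r) ℂ (E x) :=
  (trivializationAt (Cn r) E x).basisAt (EuclideanSpace.basisFun (Fin r) ℂ).toBasis
    (FiberBundle.mem_baseSet_trivializationAt (Cn r) E x)

theorem frameBasis_apply (x : X) (i : Fin r) : frameBasis E x i = localFrame E x i x := by
  simp [frameBasis, localFrame, Trivialization.basisAt, stdVec]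

/-- The metric matrix `h_{i k̄} = h(e_i, e_k)` of the local holomorphic frame around `x`, as a
function of the preferred holomorphic coordinates around `x`. -/
def metricMatrix (h : HermitianMetric n r E) (x : X) (z : Cn n) : Matrix (Fin r) (Fin r) ℂ :=
  Matrix.of fun i k =>
    h.form ((chartAt (Cn n) x).symm z) (localFrame E x i _) (localFrame E x k _)

/-- The endomorphism `R_{α β̄}` of `E x` in the Chern curvature
`R^E_x = R_{α β̄} dz^α ∧ dz̄^β`, for the preferred holomorphic coordinates around `x`. -/
def curvatureEnd (h : HermitianMetric n r E) (x : X) (α β : Fin n) : E x →ₗ[ℂ] E x :=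
  Matrix.toLin (frameBasis E x) (frameBasis E x)
    (curvatureMatrix (metricMatrix h x) α β (chartAt (Cn n) x x))

/-- The covariant coefficients `R_{i j̄ α β̄} = R^k_{i α β̄} h_{k j̄} = h(R_{α β̄} e_i, e_j)` at `x`. -/
def curvatureCoeff (h : HermitianMetric n r E) (x : X) (i j : Fin r) (α β : Fin n) : ℂ :=
  h.form x (curvatureEnd h x α β (frameBasis E x i)) (frameBasis E x j)

/-- The tangent vector `∂_α` at `x`. -/
def tangentVec (x : X) (α : Fin n) : HolTangent n x := stdVec α

/-- The coordinate form `dz^α` at `x`. -/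
def dz (x : X) (α : Fin n) : HolTangent n x →ₗ[ℂ] ℂ :=
  (EuclideanSpace.proj α : Cn n →L[ℂ] ℂ).toLinearMap

/-- The conjugate of a `(1,0)`-form: a `(0,1)`-form. -/
def conj10 {x : X} (η : HolTangent n x →ₗ[ℂ] ℂ) : HolTangent n x →ₗ⋆[ℂ] ℂ where
  toFun v := starRingEnd ℂ (η v)
  map_add' v w := by simp
  map_smul' c v := by simp

/-- The conjugate of a `(0,1)`-form: a `(1,0)`-form. -/
def conj01 {x : X} (η : HolTangent n x →ₗ⋆[ℂ] ℂ) : HolTangent n x →ₗ[ℂ] ℂ where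
  toFun v := starRingEnd ℂ (η v)
  map_add' v w := by simp
  map_smul' c v := by simp

/-- The wedge product of two complex-valued 1-forms on the real tangent space at `x`, evaluated on
two tangent vectors. -/
def wedge {x : X} (η ζ : HolTangent n x → ℂ) (v w : HolTangent n x) : ℂ :=
  η v * ζ w - η w * ζ v

/-- The Chern curvature `R^E_x = R_{α β̄} dz^α ∧ dz̄^β`, a 2-form on the tangent space at `x` with
values in `End (E x)`. -/
def chernCurvature (h : HermitianMetric n r E) (x : X) (v w : HolTangent n x) :
    E x →ₗ[ℂ] E x :=
  ∑ α, ∑ β, wedge (dz x α) (conj10 (dz x β)) v w • curvatureEnd h x α β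

/-- The array `u = (u^{i α})` is the array of coefficients of an element `u^{i α} e_i ⊗ ∂_α` of
`E_x ⊗ U` (or of an element `u^{ī α} ē_i ⊗ ∂_α` of `Ē_x ⊗ U`): every `u^{i α} ∂_α` lies in `U`. -/
def IsTensorIn {x : X} (U : Submodule ℂ (HolTangent n x)) (u : Fin r → Fin n → ℂ) : Prop :=
  ∀ i, ∑ α, u i α • tangentVec x α ∈ U

/-- The Nakano form `R_{i j̄ α β̄} u^{i α} conj(v^{j β})`. -/
def nakanoForm (h : HermitianMetric n r E) (x : X) (u v : Fin r → Fin n → ℂ) : ℂ :=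
  ∑ i, ∑ j, ∑ α, ∑ β, curvatureCoeff h x i j α β * u i α * starRingEnd ℂ (v j β)

/-- The dual Nakano form `R_{i j̄ α β̄} v^{j̄ α} conj(v^{ī β})`. -/
def dualNakanoForm (h : HermitianMetric n r E) (x : X) (v : Fin r → Fin n → ℂ) : ℂ :=
  ∑ i, ∑ j, ∑ α, ∑ β, curvatureCoeff h x i j α β * v j α * starRingEnd ℂ (v i β)

/-- Strongly decomposably non-negative of type I. (The order of `ℂ` is used: `0 ≤ z` says that `z`
is real and non-negative.) -/
def IsStronglyDecomposablyNonnegI (h : HermitianMetric n r E) : Prop :=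
  ∀ x : X, ∃ U V : Submodule ℂ (HolTangent n x), IsCompl U V ∧
    (∀ u, IsTensorIn (r := r) U u → u ≠ 0 → 0 ≤ nakanoForm h x u u) ∧
    (∀ u v, IsTensorIn (r := r) U u → IsTensorIn (r := r) V v → nakanoForm h x u v = 0) ∧
    (∀ v, IsTensorIn (r := r) V v → v ≠ 0 → 0 ≤ dualNakanoForm h x v)

/-- Strongly decomposably positive of type I. -/
def IsStronglyDecomposablyPosI (h : HermitianMetric n r E) : Prop :=
  ∀ x : X, ∃ U V : Submodule ℂ (HolTangent n x), IsCompl U V ∧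
    (∀ u, IsTensorIn (r := r) U u → u ≠ 0 → 0 < nakanoForm h x u u) ∧
    (∀ u v, IsTensorIn (r := r) U u → IsTensorIn (r := r) V v → nakanoForm h x u v = 0) ∧
    (∀ v, IsTensorIn (r := r) V v → v ≠ 0 → 0 < dualNakanoForm h x v)

/-- A basis `e` of the fibre `E x` is a unitary frame at `x`: `h(e_i, e_j) = δ_{ij}`. -/
def IsUnitaryFrame (h : HermitianMetric n r E) {x : X} (e : Module.Basis (Fin r) ℂ (E x)) :
    Prop :=
  ∀ i j, h.form x (e i) (e j) = if i = j then 1 else 0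

/-- With respect to the frame `e` of `E x`, the Chern curvature matrix at `x` is
`R = - B ∧ B̄ᵀ + A ∧ Āᵀ`, with `B` an `r × N₂` matrix of `(0,1)`-forms and `A` an `r × N₁` matrix
of `(1,0)`-forms. -/
def CurvatureFactors (h : HermitianMetric n r E) {x : X} (e : Module.Basis (Fin r) ℂ (E x))
    {N₁ N₂ : ℕ} (B : Matrix (Fin r) (Fin N₂) (HolTangent n x →ₗ⋆[ℂ] ℂ))
    (A : Matrix (Fin r) (Fin N₁) (HolTangent n x →ₗ[ℂ] ℂ)) : Prop :=
  ∀ (v w : HolTangent n x) (j i : Fin r),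
    LinearMap.toMatrix e e (chernCurvature h x v w) j i =
      -(∑ p, wedge (B j p) (conj01 (B i p)) v w) + ∑ p, wedge (A j p) (conj10 (A i p)) v w

/-- `span_ℂ {B̄}`: the span of the conjugates of the entries of `B`. -/
def spanBBar {x : X} {N : ℕ} (B : Matrix (Fin r) (Fin N) (HolTangent n x →ₗ⋆[ℂ] ℂ)) :
    Submodule ℂ (HolTangent n x →ₗ[ℂ] ℂ) :=
  Submodule.span ℂ (Set.range fun q : Fin r × Fin N => conj01 (B q.1 q.2))

/-- `span_ℂ {A}`: the span of the entries of `A`. -/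
def spanA {x : X} {N : ℕ} (A : Matrix (Fin r) (Fin N) (HolTangent n x →ₗ[ℂ] ℂ)) :
    Submodule ℂ (HolTangent n x →ₗ[ℂ] ℂ) :=
  Submodule.span ℂ (Set.range fun q : Fin r × Fin N => A q.1 q.2)

/-- The matrix `𝐁 = (B_{i p ᾱ})_{p, i α}` with rows `p` and columns `(i, α)`, where
`B_{i p} = B_{i p ᾱ} dz̄^α`. All `α = 1, …, n` are kept: the rank does not depend on the
coordinates, and in coordinates adapted to a decomposition `T = U ⊕ V` such that the entries of `B`
vanish on `V` the columns that belong to `V` are zero. -/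
def boldB {x : X} {N : ℕ} (B : Matrix (Fin r) (Fin N) (HolTangent n x →ₗ⋆[ℂ] ℂ)) :
    Matrix (Fin N) (Fin r × Fin n) ℂ :=
  Matrix.of fun p q => B q.1 p (tangentVec x q.2)

/-- The matrix `𝐀 = (A_{j p α})_{p, j α}` with rows `p` and columns `(j, α)`, where
`A_{j p} = A_{j p α} dz^α`. -/
def boldA {x : X} {N : ℕ} (A : Matrix (Fin r) (Fin N) (HolTangent n x →ₗ[ℂ] ℂ)) :
    Matrix (Fin N) (Fin r × Fin n) ℂ :=
  Matrix.of fun p q => A q.1 p (tangentVec x q.2)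

end Bundle

end ChernCriterion

end

/-! In a unitary frame at `x`, the curvature matrix is the antisymmetrization of the matrix `K` of
sesquilinear forms `K_{ij} = R_{i j̄ α β̄} dz^α ⊗ dz̄^β`. A sesquilinear form over `ℂ` is determined
by its antisymmetrization, so (1) says `K = φ φ* + (ψ ψ*)ᵀ` with `φ = B̄` and `ψ = A`; condition (2)
says that `φ` and `ψ` take values in `U*` and `V*` for some decomposition `T = U ⊕ V`. Given such a
factorization, `K` is block diagonal, with Nakano form `‖φ u‖²` on `U` and dual Nakano form
`‖ψ v‖²` on `V`. Conversely `K` is Hermitian, because `-∂̄∂h + ∂h · h⁻¹ · ∂̄h` is, so that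
semi-definiteness on `U` and `V` yields `φ` and `ψ`. Strict positivity means that `u ↦ φ u` and
`v ↦ ψ v` are injective on `U` and `V`, that is, of the largest possible ranks `r dim U` and
`r dim V`. The type I condition does not depend on the frame, hence one unitary frame is as good as
another. -/

noncomputable section

namespace ChernCriterion

open Module (Dual finrank)
open scoped ComplexConjugate

section DualArray

variable {k T ι κ κ' : Type*} [Field k] [AddCommGroup T] [Module k T]

theorem inf_eq_bot_iff_exists_isCompl [FiniteDimensional k T] {S S' : Submodule k (Dual k T)} :
    S ⊓ S' = ⊥ ↔
      ∃ U V : Submodule k T, IsCompl U V ∧ S ≤ V.dualAnnihilator ∧ S' ≤ U.dualAnnihilator := by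
  constructor
  · intro h
    have hsup : S'.dualCoannihilator ⊔ S.dualCoannihilator = ⊤ := by
      rw [← Subspace.dualAnnihilator_inj, Submodule.dualAnnihilator_sup_eq,
        Subspace.dualCoannihilator_dualAnnihilator_eq,
        Subspace.dualCoannihilator_dualAnnihilator_eq, Submodule.dualAnnihilator_top, inf_comm, h]
    obtain ⟨U, hU, hUV⟩ := (codisjoint_iff.mpr hsup).exists_isCompl
    exact ⟨U, S.dualCoannihilator, hUV, S.le_dualCoannihilator_dualAnnihilator,
      Submodule.le_dualAnnihilator_iff_le_dualCoannihilator.mpr hU⟩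
  · rintro ⟨U, V, hUV, hS, hS'⟩
    rw [eq_bot_iff, ← Submodule.dualAnnihilator_top (R := k) (M := T), ← hUV.symm.sup_eq_top,
      Submodule.dualAnnihilator_sup_eq]
    exact inf_le_inf hS hS'

/-- The span of the entries of an array of functionals. -/
def entrySpan (φ : Matrix ι κ (Dual k T)) : Submodule k (Dual k T) :=
  Submodule.span k (Set.range fun q : ι × κ => φ q.1 q.2)

/-- All entries of an array of functionals vanish on the subspace `V`. -/
def VanishesOn (φ : Matrix ι κ (Dual k T)) (V : Submodule k T) : Prop :=
  ∀ i p, ∀ v ∈ V, φ i p v = 0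

theorem entrySpan_le_dualAnnihilator_iff {φ : Matrix ι κ (Dual k T)} {V : Submodule k T} :
    entrySpan φ ≤ V.dualAnnihilator ↔ VanishesOn φ V := by
  simp only [entrySpan, VanishesOn, Submodule.span_le, Set.range_subset_iff, Prod.forall,
    SetLike.mem_coe, Submodule.mem_dualAnnihilator]

theorem entrySpan_inf_eq_bot_iff [FiniteDimensional k T] {φ : Matrix ι κ (Dual k T)}
    {ψ : Matrix ι κ' (Dual k T)} :
    entrySpan φ ⊓ entrySpan ψ = ⊥ ↔
      ∃ U V : Submodule k T, IsCompl U V ∧ VanishesOn φ V ∧ VanishesOn ψ U := by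
  simp only [inf_eq_bot_iff_exists_isCompl, entrySpan_le_dualAnnihilator_iff]

theorem VanishesOn.apply_projection {φ : Matrix ι κ (Dual k T)} {U V : Submodule k T}
    (hφ : VanishesOn φ V) (hUV : IsCompl U V) (i : ι) (p : κ) (v : T) :
    φ i p (U.projection V hUV v) = φ i p v := by
  rw [← sub_eq_zero, ← map_sub, ← neg_sub, map_neg, hφ i p _ (Submodule.sub_projection_mem hUV v),
    neg_zero]

variable [Fintype ι]

/-- The linear map `(u_i)_i ↦ (∑ i, φ_{ip}(u_i))_p` attached to an array of functionals. -/
def contract (φ : Matrix ι κ (Dual k T)) : (ι → T) →ₗ[k] κ → k :=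
  LinearMap.pi fun p => ∑ i, φ i p ∘ₗ LinearMap.proj i

@[simp]
theorem contract_apply (φ : Matrix ι κ (Dual k T)) (u : ι → T) (p : κ) :
    contract φ u p = ∑ i, φ i p (u i) := by
  simp [contract]

theorem contract_single [DecidableEq ι] (φ : Matrix ι κ (Dual k T)) (i : ι) (v : T) :
    contract φ (Pi.single i v) = fun p => φ i p v := by
  funext p
  rw [contract_apply, Fintype.sum_eq_single i fun l hl => by simp [Pi.single_eq_of_ne hl],
    Pi.single_eq_same]

theorem VanishesOn.contract_eq_zero {φ : Matrix ι κ (Dual k T)} {V : Submodule k T}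
    (hφ : VanishesOn φ V) {v : ι → T} (hv : ∀ i, v i ∈ V) : contract φ v = 0 :=
  funext fun p => by
    rw [contract_apply]
    exact Finset.sum_eq_zero fun i _ => hφ i p _ (hv i)

theorem rank_of_apply_basis [Finite κ] {η : Type*} [Fintype η] (b : Module.Basis η k T)
    (φ : Matrix ι κ (Dual k T)) :
    (Matrix.of fun (p : κ) (q : ι × η) => φ q.1 p (b q.2)).rank =
      finrank k (LinearMap.range (contract φ)) := by
  classical
  cases nonempty_fintype κ
  set c := (Pi.basis fun _ : ι => b).reindex (Equiv.sigmaEquivProd ι η) with hc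
  have toLin_eq : Matrix.toLin c (Pi.basisFun k κ)
      (Matrix.of fun (p : κ) (q : ι × η) => φ q.1 p (b q.2)) = contract φ := by
    refine c.ext fun q => ?_
    rw [Matrix.toLin_self]
    funext p
    have hq : c q = Pi.single q.1 (b q.2) := by simp [hc, Pi.basis_apply]
    simp [hq, contract_single, -contract_apply, Pi.single_apply]
  rw [Matrix.rank_eq_finrank_range_toLin _ (Pi.basisFun k κ) c, toLin_eq]

theorem VanishesOn.range_contract {φ : Matrix ι κ (Dual k T)} {U V : Submodule k T}
    (hφ : VanishesOn φ V) (hUV : IsCompl U V) :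
    LinearMap.range (contract φ) = LinearMap.range (contract φ ∘ₗ U.subtype.compLeft ι) := by
  refine le_antisymm ?_ (LinearMap.range_comp_le_range _ _)
  rintro _ ⟨u, rfl⟩
  exact ⟨fun i => U.projectionOnto V hUV (u i), funext fun p => by
    simp [hφ.apply_projection hUV]⟩

variable [FiniteDimensional k T]

theorem VanishesOn.finrank_range_contract_le {φ : Matrix ι κ (Dual k T)} {U V : Submodule k T}
    (hφ : VanishesOn φ V) (hUV : IsCompl U V) :
    finrank k (LinearMap.range (contract φ)) ≤ Fintype.card ι * finrank k U := by
  rw [hφ.range_contract hUV]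
  exact (LinearMap.finrank_range_le _).trans_eq (by simp [Module.finrank_pi_fintype])

theorem VanishesOn.finrank_range_contract_eq_iff {φ : Matrix ι κ (Dual k T)}
    {U V : Submodule k T} (hφ : VanishesOn φ V) (hUV : IsCompl U V) :
    finrank k (LinearMap.range (contract φ)) = Fintype.card ι * finrank k U ↔
      ∀ u : ι → T, (∀ i, u i ∈ U) → contract φ u = 0 → u = 0 := by
  set f := contract φ ∘ₗ U.subtype.compLeft ι with hf
  have hdim : finrank k (LinearMap.range f) + finrank k (LinearMap.ker f) =
      Fintype.card ι * finrank k U := by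
    rw [f.finrank_range_add_finrank_ker]
    simp [Module.finrank_pi_fintype]
  calc finrank k (LinearMap.range (contract φ)) = Fintype.card ι * finrank k U
      ↔ finrank k (LinearMap.ker f) = 0 := by rw [hφ.range_contract hUV, ← hf]; omega
    _ ↔ LinearMap.ker f = ⊥ := Submodule.finrank_eq_zero
    _ ↔ ∀ u : ι → U, contract φ (fun i => (u i : T)) = 0 → u = 0 := LinearMap.ker_eq_bot'
    _ ↔ ∀ u : ι → T, (∀ i, u i ∈ U) → contract φ u = 0 → u = 0 :=
      ⟨fun h u hu h0 => funext fun i =>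
          congrArg Subtype.val (congrFun (h (fun i => ⟨u i, hu i⟩) h0) i),
        fun h u h0 => funext fun i => Subtype.ext (congrFun (h _ (fun i => (u i).2) h0) i)⟩

end DualArray

section Sesquilinear

variable {𝕜 T W ι κ : Type*} [RCLike 𝕜] [AddCommGroup T] [Module 𝕜 T] [AddCommGroup W]
  [Module 𝕜 W]

/-- Sesquilinear forms, linear in the first variable and conjugate linear in the second. -/
abbrev SesqForm (𝕜 T : Type*) [RCLike 𝕜] [AddCommGroup T] [Module 𝕜 T] : Type _ :=
  T →ₗ[𝕜] T →ₗ⋆[𝕜] 𝕜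

/-- The sesquilinear form `φ ⊗ ψ̄`. -/
def tensorConj (φ ψ : Dual 𝕜 T) : SesqForm 𝕜 T :=
  φ.smulRight ((starRingEnd 𝕜).toSemilinearMap ∘ₛₗ ψ)

@[simp]
theorem tensorConj_apply (φ ψ : Dual 𝕜 T) (v w : T) :
    tensorConj φ ψ v w = φ v * conj (ψ w) := rfl

/-- A matrix `K` of sesquilinear forms is Hermitian when `K_{ji}` is the conjugate transpose of
`K_{ij}`. -/
def IsHermitianArray (K : Matrix ι ι (SesqForm 𝕜 T)) : Prop :=
  ∀ i j v w, conj (K i j v w) = K j i w v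

theorem IsHermitianArray.transpose {K : Matrix ι ι (SesqForm 𝕜 T)} (hK : IsHermitianArray K) :
    IsHermitianArray K.transpose :=
  fun i j => hK j i

/-- The inner product attached to a positive semidefinite Hermitian form, which has the opposite
order of arguments since inner products are conjugate linear in the first variable. -/
abbrev innerCore (Q : SesqForm 𝕜 W) (hQ : ∀ v w, conj (Q v w) = Q w v)
    (hQ_nonneg : ∀ v, 0 ≤ Q v v) : PreInnerProductSpace.Core 𝕜 W where
  inner v w := Q w v
  conj_inner_symm := hQ
  re_inner_nonneg v := (RCLike.nonneg_iff.mp (hQ_nonneg v)).1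
  add_left u v w := map_add (Q w) u v
  smul_left u v c := (Q v).map_smulₛₗ c u

/-- The Hermitian form is an inner product on the quotient by its kernel, where it is expanded in
an orthonormal basis. -/
theorem exists_eq_sum_tensorConj [FiniteDimensional 𝕜 W] (Q : SesqForm 𝕜 W)
    (hQ : ∀ v w, conj (Q v w) = Q w v) (hQ_nonneg : ∀ v, 0 ≤ Q v v) :
    ∃ (N : ℕ) (φ : Fin N → Dual 𝕜 W), Q = ∑ p, tensorConj (φ p) (φ p) := by
  let core := innerCore Q hQ hQ_nonneg
  let : SeminormedAddCommGroup W := InnerProductSpace.Core.toSeminormedAddCommGroup (c := core)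
  let : InnerProductSpace 𝕜 W := InnerProductSpace.ofCore core
  let mk : W →ₗ[𝕜] SeparationQuotient W := (SeparationQuotient.mkCLM 𝕜 W).toLinearMap
  have : FiniteDimensional 𝕜 (SeparationQuotient W) :=
    Module.Finite.of_surjective mk SeparationQuotient.surjective_mk
  let b := stdOrthonormalBasis 𝕜 (SeparationQuotient W)
  refine ⟨_, fun p => innerₛₗ 𝕜 (b p) ∘ₗ mk, ?_⟩
  ext v w
  calc Q v w = inner 𝕜 (mk w) (mk v) := (SeparationQuotient.inner_mk_mk w v).symm
    _ = ∑ p, inner 𝕜 (mk w) (b p) * inner 𝕜 (b p) (mk v) := (b.sum_inner_mul_inner _ _).symm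
    _ = _ := by simp [mul_comm]

theorem exists_basis_unitary [FiniteDimensional 𝕜 W] [Fintype ι] [DecidableEq ι]
    (hι : finrank 𝕜 W = Fintype.card ι) (Q : SesqForm 𝕜 W)
    (hQ : ∀ v w, conj (Q v w) = Q w v) (hQ_pos : ∀ v, v ≠ 0 → 0 < Q v v) :
    ∃ e : Module.Basis ι 𝕜 W, ∀ i j, Q (e i) (e j) = if i = j then 1 else 0 := by
  have hQ_nonneg (v : W) : 0 ≤ Q v v := by
    rcases eq_or_ne v 0 with rfl | hv
    · simp
    · exact (hQ_pos v hv).le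
  let core : InnerProductSpace.Core 𝕜 W :=
    { innerCore Q hQ hQ_nonneg with
      definite := fun v => not_imp_not.mp fun hv => (hQ_pos v hv).ne' }
  let : NormedAddCommGroup W := core.toNormedAddCommGroup
  let : InnerProductSpace 𝕜 W := InnerProductSpace.ofCore core.toCore
  let b := (stdOrthonormalBasis 𝕜 W).reindex ((finCongr hι).trans (Fintype.equivFin ι).symm)
  refine ⟨b.toBasis, fun i j => ?_⟩
  calc Q (b.toBasis i) (b.toBasis j) = inner 𝕜 (b j) (b i) := by rw [b.coe_toBasis]; rfl
    _ = if i = j then 1 else 0 := by simp [orthonormal_iff_ite.mp b.orthonormal, eq_comm]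

theorem det_ne_zero_of_pos [Fintype ι] [DecidableEq ι] (b : Module.Basis ι 𝕜 W) {Q : SesqForm 𝕜 W}
    (hQ_pos : ∀ v, v ≠ 0 → 0 < Q v v) :
    (Matrix.of fun i k => Q (b i) (b k)).det ≠ 0 := by
  rw [ne_eq, ← Matrix.exists_vecMul_eq_zero_iff]
  rintro ⟨c, hc, hcQ⟩
  have hQ_zero : Q (∑ i, c i • b i) = 0 := b.ext fun k => by
    simpa [Matrix.vecMul, dotProduct] using congrFun hcQ k
  have hc_sum : ∑ i, c i • b i ≠ 0 := fun h0 =>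
    hc (funext (Fintype.linearIndependent_iff.mp b.linearIndependent c h0))
  simpa [hQ_zero] using hQ_pos _ hc_sum

theorem sub_swap_eq_sub_swap_iff {T : Type*} [AddCommGroup T] [Module ℂ T] {Q Q' : SesqForm ℂ T} :
    (∀ v w, Q v w - Q w v = Q' v w - Q' w v) ↔ Q = Q' := by
  refine ⟨fun h => ?_, fun h _ _ => by rw [h]⟩
  ext v w
  have h_real := h v w
  have h_imag := h (Complex.I • v) w
  simp only [map_smul, LinearMap.smul_apply, map_smulₛₗ, smul_eq_mul, Complex.conj_I] at h_imag
  have h_two : 2 * Complex.I * (Q v w - Q' v w) = 0 := by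
    linear_combination h_imag + Complex.I * h_real
  simpa [sub_eq_zero] using h_two

/-- The matrix of sesquilinear forms `∑ p, φ_{ip} ⊗ conj φ_{jp}`. -/
def gram [Fintype κ] (φ : Matrix ι κ (Dual 𝕜 T)) : Matrix ι ι (SesqForm 𝕜 T) :=
  Matrix.of fun i j => ∑ p, tensorConj (φ i p) (φ j p)

@[simp]
theorem gram_apply [Fintype κ] (φ : Matrix ι κ (Dual 𝕜 T)) (i j : ι) (v w : T) :
    gram φ i j v w = ∑ p, φ i p v * conj (φ j p w) := by
  simp [gram]

variable [Fintype ι]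

/-- The sesquilinear form `(u, v) ↦ ∑ K_{ij}(u_i, v_j)` on `T^ι ≅ 𝕜^ι ⊗ T`. -/
def blockForm (K : Matrix ι ι (SesqForm 𝕜 T)) : SesqForm 𝕜 (ι → T) :=
  LinearMap.mk₂'ₛₗ (RingHom.id 𝕜) (starRingEnd 𝕜) (fun u v => ∑ i, ∑ j, K i j (u i) (v j))
    (fun _ _ _ => by simp [Finset.sum_add_distrib])
    (fun _ _ _ => by simp [Finset.mul_sum])
    (fun _ _ _ => by simp [Finset.sum_add_distrib])
    (fun _ _ _ => by simp [Finset.mul_sum])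

@[simp]
theorem blockForm_apply (K : Matrix ι ι (SesqForm 𝕜 T)) (u v : ι → T) :
    blockForm K u v = ∑ i, ∑ j, K i j (u i) (v j) := rfl

theorem blockForm_single [DecidableEq ι] (K : Matrix ι ι (SesqForm 𝕜 T)) (i j : ι) (v w : T) :
    blockForm K (Pi.single i v) (Pi.single j w) = K i j v w := by
  rw [blockForm_apply, Fintype.sum_eq_single i, Fintype.sum_eq_single j]
  · simp
  · intro l hl
    simp [Pi.single_eq_of_ne hl]
  · intro l hl
    simp [Pi.single_eq_of_ne hl]

theorem IsHermitianArray.conj_blockForm {K : Matrix ι ι (SesqForm 𝕜 T)} (hK : IsHermitianArray K)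
    (u v : ι → T) : conj (blockForm K u v) = blockForm K v u := by
  simp only [blockForm_apply, map_sum, hK _ _ _ _]
  exact Finset.sum_comm

theorem blockForm_gram [Fintype κ] (φ : Matrix ι κ (Dual 𝕜 T)) (u v : ι → T) :
    blockForm (gram φ) u v = contract φ u ⬝ᵥ star (contract φ v) := by
  simp only [blockForm_apply, gram_apply, dotProduct, Pi.star_apply, RCLike.star_def,
    contract_apply, map_sum, Finset.sum_mul_sum]
  exact (Finset.sum_congr rfl fun i _ => Finset.sum_comm).trans Finset.sum_comm

theorem IsHermitianArray.exists_eq_gram [FiniteDimensional 𝕜 T] {K : Matrix ι ι (SesqForm 𝕜 T)}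
    (hK : IsHermitianArray K) (hK_nonneg : ∀ u, 0 ≤ blockForm K u u) :
    ∃ (N : ℕ) (φ : Matrix ι (Fin N) (Dual 𝕜 T)), K = gram φ := by
  classical
  obtain ⟨N, φ, hφ⟩ := exists_eq_sum_tensorConj (blockForm K) hK.conj_blockForm hK_nonneg
  refine ⟨N, Matrix.of fun i p => φ p ∘ₗ LinearMap.single 𝕜 (fun _ => T) i, ?_⟩
  ext i j v w
  rw [← blockForm_single, hφ]
  simp

end Sesquilinear

section Decomposition

variable {𝕜 T ι κ κ' : Type*} [RCLike 𝕜] [AddCommGroup T] [Module 𝕜 T] [Fintype ι]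

/-- `T = U ⊕ V` is a type I decomposition for the matrix `K` of sesquilinear forms and the property
`P` (non-negativity or positivity of a number): the Nakano form `blockForm K` satisfies `P` on
`𝕜^ι ⊗ U`, the dual Nakano form `blockForm Kᵀ` satisfies `P` on `𝕜^ι ⊗ V`, and the former vanishes
on mixed arguments. -/
structure IsTypeIDecomposition (P : 𝕜 → Prop) (K : Matrix ι ι (SesqForm 𝕜 T))
    (U V : Submodule 𝕜 T) : Prop where
  isCompl : IsCompl U V
  nakano : ∀ u : ι → T, (∀ i, u i ∈ U) → u ≠ 0 → P (blockForm K u u)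
  cross : ∀ u v : ι → T, (∀ i, u i ∈ U) → (∀ i, v i ∈ V) → blockForm K u v = 0
  dualNakano : ∀ v : ι → T, (∀ i, v i ∈ V) → v ≠ 0 → P (blockForm K.transpose v v)

theorem IsTypeIDecomposition.mono {P P' : 𝕜 → Prop} (hP : ∀ c, P c → P' c)
    {K : Matrix ι ι (SesqForm 𝕜 T)} {U V : Submodule 𝕜 T} (h : IsTypeIDecomposition P K U V) :
    IsTypeIDecomposition P' K U V where
  isCompl := h.isCompl
  nakano u hu hu0 := hP _ (h.nakano u hu hu0)
  cross := h.cross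
  dualNakano v hv hv0 := hP _ (h.dualNakano v hv hv0)

section Frame

variable {F : Type*} [AddCommGroup F] [Module 𝕜 F]

/-- The matrix `(R(e_i, e_j))` of a form `R` with values in sesquilinear forms. -/
def frameMatrix (R : F →ₗ[𝕜] F →ₗ⋆[𝕜] SesqForm 𝕜 T) (e : ι → F) : Matrix ι ι (SesqForm 𝕜 T) :=
  Matrix.of fun i j => R (e i) (e j)

open scoped Matrix.Module

theorem frameMatrix_eq_sum (R : F →ₗ[𝕜] F →ₗ⋆[𝕜] SesqForm 𝕜 T) (e e' : Module.Basis ι 𝕜 F)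
    (i j : ι) :
    frameMatrix R e' i j =
      ∑ k, ∑ l, (e.toMatrix e' k i * conj (e.toMatrix e' l j)) • frameMatrix R e k l := by
  rw [frameMatrix, Matrix.of_apply, ← e.sum_toMatrix_smul_self e' i,
    ← e.sum_toMatrix_smul_self e' j]
  simp only [map_sum, LinearMap.sum_apply, map_smulₛₗ, LinearMap.smul_apply, RingHom.id_apply,
    frameMatrix, Matrix.of_apply, Finset.smul_sum, mul_smul]
  rw [Finset.sum_comm]
  exact Finset.sum_congr rfl fun k _ => Finset.sum_congr rfl fun l _ => smul_comm _ _ _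

theorem sum_sum_sum_sum_comm {M : Type*} [AddCommMonoid M] (f : ι → ι → ι → ι → M) :
    ∑ i, ∑ j, ∑ k, ∑ l, f i j k l = ∑ k, ∑ l, ∑ j, ∑ i, f i j k l := by
  simp only [← Fintype.sum_prod_type']
  exact Fintype.sum_equiv
    ⟨fun x => (x.2.2.1, x.2.2.2, x.2.1, x.1), fun x => (x.2.2.2, x.2.2.1, x.1, x.2.1),
      fun _ => rfl, fun _ => rfl⟩ _ _ fun _ => rfl

variable [DecidableEq ι]

theorem blockForm_frameMatrix (R : F →ₗ[𝕜] F →ₗ⋆[𝕜] SesqForm 𝕜 T) (e e' : Module.Basis ι 𝕜 F)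
    (u v : ι → T) :
    blockForm (frameMatrix R e') u v =
      blockForm (frameMatrix R e) (e.toMatrix e' • u) (e.toMatrix e' • v) := by
  simp only [blockForm_apply, frameMatrix_eq_sum R e e', Matrix.Module.smul_apply, map_sum,
    LinearMap.sum_apply, map_smulₛₗ, LinearMap.smul_apply, RingHom.id_apply, smul_eq_mul,
    Finset.mul_sum]
  rw [sum_sum_sum_sum_comm]
  refine Fintype.sum_congr _ _ fun k => Fintype.sum_congr _ _ fun l =>
    Fintype.sum_congr _ _ fun j => Fintype.sum_congr _ _ fun i => by ring

theorem blockForm_transpose_frameMatrix (R : F →ₗ[𝕜] F →ₗ⋆[𝕜] SesqForm 𝕜 T)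
    (e e' : Module.Basis ι 𝕜 F) (u v : ι → T) :
    blockForm (frameMatrix R e').transpose u v =
      blockForm (frameMatrix R e).transpose ((e.toMatrix e').map conj • u)
        ((e.toMatrix e').map conj • v) := by
  simp only [blockForm_apply, Matrix.transpose_apply, frameMatrix_eq_sum R e e',
    Matrix.Module.smul_apply, Matrix.map_apply, map_sum, LinearMap.sum_apply, map_smulₛₗ,
    LinearMap.smul_apply, RingHom.id_apply, smul_eq_mul, Finset.mul_sum, RCLike.conj_conj]
  rw [sum_sum_sum_sum_comm, Finset.sum_comm]
  refine Fintype.sum_congr _ _ fun l => Fintype.sum_congr _ _ fun k =>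
    Fintype.sum_congr _ _ fun j => Fintype.sum_congr _ _ fun i => by ring

theorem matrix_smul_mem {U : Submodule 𝕜 T} (M : Matrix ι ι 𝕜) {u : ι → T}
    (hu : ∀ i, u i ∈ U) (i : ι) : (M • u) i ∈ U := by
  rw [Matrix.Module.smul_apply]
  exact U.sum_mem fun j _ => U.smul_mem _ (hu j)

theorem matrix_smul_ne_zero {M N : Matrix ι ι 𝕜} (hNM : N * M = 1) {u : ι → T}
    (hu : u ≠ 0) : M • u ≠ 0 := by
  intro h
  apply hu
  rw [← one_smul (Matrix ι ι 𝕜) u, ← hNM, mul_smul, h, smul_zero]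

omit [DecidableEq ι] in
theorem IsTypeIDecomposition.of_frameMatrix {P : 𝕜 → Prop} {R : F →ₗ[𝕜] F →ₗ⋆[𝕜] SesqForm 𝕜 T}
    {e : Module.Basis ι 𝕜 F} {U V : Submodule 𝕜 T}
    (h : IsTypeIDecomposition P (frameMatrix R e) U V) (e' : Module.Basis ι 𝕜 F) :
    IsTypeIDecomposition P (frameMatrix R e') U V := by
  classical
  have inv : e'.toMatrix e * e.toMatrix e' = 1 := e'.toMatrix_mul_toMatrix_flip e
  have conj_inv : (e'.toMatrix e).map conj * (e.toMatrix e').map conj = 1 := by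
    rw [← Matrix.map_mul, inv, Matrix.map_one _ (map_zero _) (map_one _)]
  refine ⟨h.isCompl, fun u hu hu0 => ?_, fun u v hu hv => ?_, fun v hv hv0 => ?_⟩
  · rw [blockForm_frameMatrix R e]
    exact h.nakano _ (matrix_smul_mem _ hu) (matrix_smul_ne_zero inv hu0)
  · rw [blockForm_frameMatrix R e]
    exact h.cross _ _ (matrix_smul_mem _ hu) (matrix_smul_mem _ hv)
  · rw [blockForm_transpose_frameMatrix R e]
    exact h.dualNakano _ (matrix_smul_mem _ hv) (matrix_smul_ne_zero conj_inv hv0)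

end Frame

/-- A factorization `K = φ φ* + (ψ ψ*)ᵀ` by functionals `φ` in `U*` and `ψ` in `V*`, for a
decomposition `T = U ⊕ V`. -/
structure IsAdaptedFactorization [Fintype κ] [Fintype κ'] (K : Matrix ι ι (SesqForm 𝕜 T))
    (U V : Submodule 𝕜 T) (φ : Matrix ι κ (Dual 𝕜 T)) (ψ : Matrix ι κ' (Dual 𝕜 T)) : Prop where
  isCompl : IsCompl U V
  eq_gram_add : K = gram φ + (gram ψ).transpose
  left_vanishes : VanishesOn φ V
  right_vanishes : VanishesOn ψ U

namespace IsAdaptedFactorization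

variable [Fintype κ] [Fintype κ'] {K : Matrix ι ι (SesqForm 𝕜 T)} {U V : Submodule 𝕜 T}
  {φ : Matrix ι κ (Dual 𝕜 T)} {ψ : Matrix ι κ' (Dual 𝕜 T)}

omit [Fintype ι] in
theorem symm (h : IsAdaptedFactorization K U V φ ψ) :
    IsAdaptedFactorization K.transpose V U ψ φ where
  isCompl := h.isCompl.symm
  eq_gram_add := by
    rw [h.eq_gram_add, Matrix.transpose_add, Matrix.transpose_transpose, add_comm]
  left_vanishes := h.right_vanishes
  right_vanishes := h.left_vanishes

theorem blockForm_apply (h : IsAdaptedFactorization K U V φ ψ) {u : ι → T} (hu : ∀ i, u i ∈ U)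
    (v : ι → T) : blockForm K u v = contract φ u ⬝ᵥ star (contract φ v) := by
  rw [← blockForm_gram, ChernCriterion.blockForm_apply, ChernCriterion.blockForm_apply]
  refine Finset.sum_congr rfl fun i _ => Finset.sum_congr rfl fun j _ => ?_
  simp [h.eq_gram_add, h.right_vanishes _ _ _ (hu i)]

theorem isTypeIDecomposition_iff {P : 𝕜 → Prop} (h : IsAdaptedFactorization K U V φ ψ) :
    IsTypeIDecomposition P K U V ↔
      (∀ u : ι → T, (∀ i, u i ∈ U) → u ≠ 0 → P (contract φ u ⬝ᵥ star (contract φ u))) ∧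
      ∀ v : ι → T, (∀ i, v i ∈ V) → v ≠ 0 → P (contract ψ v ⬝ᵥ star (contract ψ v)) := by
  constructor
  · rintro ⟨-, hU, -, hV⟩
    exact ⟨fun u hu hu0 => h.blockForm_apply hu u ▸ hU u hu hu0,
      fun v hv hv0 => h.symm.blockForm_apply hv v ▸ hV v hv hv0⟩
  · rintro ⟨hU, hV⟩
    refine ⟨h.isCompl, fun u hu hu0 => ?_, fun u v hu hv => ?_, fun v hv hv0 => ?_⟩
    · rw [h.blockForm_apply hu]
      exact hU u hu hu0
    · rw [h.blockForm_apply hu, h.left_vanishes.contract_eq_zero hv, star_zero, dotProduct_zero]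
    · rw [h.symm.blockForm_apply hv]
      exact hV v hv hv0

theorem isTypeIDecomposition_nonneg (h : IsAdaptedFactorization K U V φ ψ) :
    IsTypeIDecomposition (0 ≤ ·) K U V :=
  h.isTypeIDecomposition_iff.mpr ⟨fun _ _ _ => dotProduct_self_star_nonneg _,
    fun _ _ _ => dotProduct_self_star_nonneg _⟩

theorem isTypeIDecomposition_pos_iff [FiniteDimensional 𝕜 T]
    (h : IsAdaptedFactorization K U V φ ψ) :
    IsTypeIDecomposition (0 < ·) K U V ↔
      finrank 𝕜 (LinearMap.range (contract ψ)) = Fintype.card ι * finrank 𝕜 V ∧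
      finrank 𝕜 (LinearMap.range (contract φ)) = Fintype.card ι * finrank 𝕜 U := by
  rw [h.isTypeIDecomposition_iff, h.right_vanishes.finrank_range_contract_eq_iff h.isCompl.symm,
    h.left_vanishes.finrank_range_contract_eq_iff h.isCompl, and_comm]
  simp only [Matrix.dotProduct_self_star_pos_iff, ne_eq, not_imp_not]

end IsAdaptedFactorization

theorem IsHermitianArray.exists_vanishesOn_eq_gram [FiniteDimensional 𝕜 T]
    {K : Matrix ι ι (SesqForm 𝕜 T)} (hK : IsHermitianArray K) {U V : Submodule 𝕜 T}
    (hUV : IsCompl U V) (hU : ∀ u : ι → T, (∀ i, u i ∈ U) → u ≠ 0 → 0 ≤ blockForm K u u) :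
    ∃ (N : ℕ) (φ : Matrix ι (Fin N) (Dual 𝕜 T)), VanishesOn φ V ∧
      ∀ i j, ∀ v ∈ U, ∀ w ∈ U, K i j v w = gram φ i j v w := by
  let KU : Matrix ι ι (SesqForm 𝕜 U) := K.map (·.domRestrict₁₂ U U)
  have KU_hermitian : IsHermitianArray KU := fun i j v w => hK i j v w
  have KU_nonneg (u : ι → U) : 0 ≤ blockForm KU u u := by
    rcases eq_or_ne u 0 with rfl | hu
    · simp
    · exact hU (fun i => u i) (fun i => (u i).2) fun h0 =>
        hu (funext fun i => Subtype.ext (congrFun h0 i))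
  obtain ⟨N, φ, hφ⟩ := KU_hermitian.exists_eq_gram KU_nonneg
  refine ⟨N, φ.map (· ∘ₗ U.projectionOnto V hUV), fun i p v hv => ?_, fun i j v hv w hw => ?_⟩
  · simp [Submodule.projectionOnto_apply_of_mem_right hUV hv]
  · calc K i j v w = KU i j ⟨v, hv⟩ ⟨w, hw⟩ := rfl
      _ = gram φ i j ⟨v, hv⟩ ⟨w, hw⟩ := by rw [hφ]
      _ = _ := by
        simp [Submodule.projectionOnto_apply_of_mem_left hUV hv,
          Submodule.projectionOnto_apply_of_mem_left hUV hw]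

theorem IsTypeIDecomposition.apply_eq_zero {P : 𝕜 → Prop} {K : Matrix ι ι (SesqForm 𝕜 T)}
    {U V : Submodule 𝕜 T} (h : IsTypeIDecomposition P K U V) (i j : ι) {u v : T} (hu : u ∈ U)
    (hv : v ∈ V) : K i j u v = 0 := by
  classical
  rw [← blockForm_single]
  refine h.cross _ _ (fun l => ?_) (fun l => ?_)
  · rcases eq_or_ne l i with rfl | hl <;> simp [*]
  · rcases eq_or_ne l j with rfl | hl <;> simp [*]

theorem IsTypeIDecomposition.exists_isAdaptedFactorization [FiniteDimensional 𝕜 T]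
    {K : Matrix ι ι (SesqForm 𝕜 T)} (hK : IsHermitianArray K) {U V : Submodule 𝕜 T}
    (h : IsTypeIDecomposition (0 ≤ ·) K U V) :
    ∃ (N₁ N₂ : ℕ) (φ : Matrix ι (Fin N₂) (Dual 𝕜 T)) (ψ : Matrix ι (Fin N₁) (Dual 𝕜 T)),
      IsAdaptedFactorization K U V φ ψ := by
  obtain ⟨N₂, φ, hφV, hφ⟩ := hK.exists_vanishesOn_eq_gram h.isCompl h.nakano
  obtain ⟨N₁, ψ, hψU, hψ⟩ :=
    hK.transpose.exists_vanishesOn_eq_gram h.isCompl.symm h.dualNakano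
  refine ⟨N₁, N₂, φ, ψ, h.isCompl, ?_, hφV, hψU⟩
  ext i j v w
  have exists_add (t : T) : ∃ u ∈ U, ∃ v ∈ V, u + v = t :=
    Submodule.mem_sup.mp (h.isCompl.sup_eq_top ▸ Submodule.mem_top)
  obtain ⟨v₁, hv₁, v₂, hv₂, rfl⟩ := exists_add v
  obtain ⟨w₁, hw₁, w₂, hw₂, rfl⟩ := exists_add w
  have cross' : K i j v₂ w₁ = 0 := by
    rw [← hK j i, h.apply_eq_zero j i hw₁ hv₂, map_zero]
  have on_U := hφ i j v₁ hv₁ w₁ hw₁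
  have on_V : K i j v₂ w₂ = _ := hψ j i v₂ hv₂ w₂ hw₂
  rw [gram_apply] at on_U on_V
  simp [h.apply_eq_zero i j hv₁ hw₂, cross', on_U, on_V, hφV _ _ _ hv₂, hφV _ _ _ hw₂,
    hψU _ _ _ hv₁, hψU _ _ _ hw₁]

variable [FiniteDimensional 𝕜 T]

theorem IsHermitianArray.exists_isTypeIDecomposition_nonneg_iff {K : Matrix ι ι (SesqForm 𝕜 T)}
    (hK : IsHermitianArray K) :
    (∃ U V, IsTypeIDecomposition (0 ≤ ·) K U V) ↔
      ∃ (N₁ N₂ : ℕ) (φ : Matrix ι (Fin N₂) (Dual 𝕜 T)) (ψ : Matrix ι (Fin N₁) (Dual 𝕜 T)),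
        K = gram φ + (gram ψ).transpose ∧ entrySpan φ ⊓ entrySpan ψ = ⊥ := by
  constructor
  · rintro ⟨U, V, h⟩
    obtain ⟨N₁, N₂, φ, ψ, hf⟩ := h.exists_isAdaptedFactorization hK
    exact ⟨N₁, N₂, φ, ψ, hf.eq_gram_add, entrySpan_inf_eq_bot_iff.mpr
      ⟨U, V, hf.isCompl, hf.left_vanishes, hf.right_vanishes⟩⟩
  · rintro ⟨N₁, N₂, φ, ψ, hK_eq, hspan⟩
    obtain ⟨U, V, hUV, hφ, hψ⟩ := entrySpan_inf_eq_bot_iff.mp hspan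
    exact ⟨U, V, IsAdaptedFactorization.isTypeIDecomposition_nonneg ⟨hUV, hK_eq, hφ, hψ⟩⟩

theorem IsHermitianArray.exists_isTypeIDecomposition_pos_iff_vanishesOn
    {K : Matrix ι ι (SesqForm 𝕜 T)} (hK : IsHermitianArray K) :
    (∃ U V, IsTypeIDecomposition (0 < ·) K U V) ↔
      ∃ (N₁ N₂ : ℕ) (φ : Matrix ι (Fin N₂) (Dual 𝕜 T)) (ψ : Matrix ι (Fin N₁) (Dual 𝕜 T)),
        K = gram φ + (gram ψ).transpose ∧ entrySpan φ ⊓ entrySpan ψ = ⊥ ∧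
        ∃ U V : Submodule 𝕜 T, IsCompl U V ∧ VanishesOn φ V ∧ VanishesOn ψ U ∧
          finrank 𝕜 (LinearMap.range (contract ψ)) = Fintype.card ι * finrank 𝕜 V ∧
          finrank 𝕜 (LinearMap.range (contract φ)) = Fintype.card ι * finrank 𝕜 U := by
  constructor
  · rintro ⟨U, V, h⟩
    obtain ⟨N₁, N₂, φ, ψ, hf⟩ :=
      (h.mono fun _ => le_of_lt).exists_isAdaptedFactorization hK
    exact ⟨N₁, N₂, φ, ψ, hf.eq_gram_add, entrySpan_inf_eq_bot_iff.mpr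
      ⟨U, V, hf.isCompl, hf.left_vanishes, hf.right_vanishes⟩, U, V, hf.isCompl,
      hf.left_vanishes, hf.right_vanishes, hf.isTypeIDecomposition_pos_iff.mp h⟩
  · rintro ⟨N₁, N₂, φ, ψ, hK_eq, -, U, V, hUV, hφ, hψ, hrank⟩
    exact ⟨U, V, (IsAdaptedFactorization.isTypeIDecomposition_pos_iff
      ⟨hUV, hK_eq, hφ, hψ⟩).mpr hrank⟩

theorem IsHermitianArray.exists_isTypeIDecomposition_pos_iff {K : Matrix ι ι (SesqForm 𝕜 T)}
    (hK : IsHermitianArray K) :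
    (∃ U V, IsTypeIDecomposition (0 < ·) K U V) ↔
      ∃ (N₁ N₂ : ℕ) (φ : Matrix ι (Fin N₂) (Dual 𝕜 T)) (ψ : Matrix ι (Fin N₁) (Dual 𝕜 T)),
        K = gram φ + (gram ψ).transpose ∧ entrySpan φ ⊓ entrySpan ψ = ⊥ ∧
        ∃ U V : Submodule 𝕜 T, IsCompl U V ∧
          finrank 𝕜 (LinearMap.range (contract ψ)) = Fintype.card ι * finrank 𝕜 V ∧
          finrank 𝕜 (LinearMap.range (contract φ)) = Fintype.card ι * finrank 𝕜 U := by
  rw [hK.exists_isTypeIDecomposition_pos_iff_vanishesOn]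
  constructor
  · rintro ⟨N₁, N₂, φ, ψ, hK_eq, hspan, U, V, hUV, -, -, hrank⟩
    exact ⟨N₁, N₂, φ, ψ, hK_eq, hspan, U, V, hUV, hrank⟩
  · rintro ⟨N₁, N₂, φ, ψ, hK_eq, hspan, U₀, V₀, hUV₀, hψ_rank, hφ_rank⟩
    obtain ⟨U, V, hUV, hφ, hψ⟩ := entrySpan_inf_eq_bot_iff.mp hspan
    have hφ_le := hφ.finrank_range_contract_le hUV
    have hψ_le := hψ.finrank_range_contract_le hUV.symm
    -- both bounds are attained, since `dim U + dim V = dim U₀ + dim V₀`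
    have hdim : Fintype.card ι * finrank 𝕜 U + Fintype.card ι * finrank 𝕜 V =
        Fintype.card ι * finrank 𝕜 U₀ + Fintype.card ι * finrank 𝕜 V₀ := by
      rw [← mul_add, ← mul_add, Submodule.finrank_add_eq_of_isCompl hUV,
        Submodule.finrank_add_eq_of_isCompl hUV₀]
    exact ⟨N₁, N₂, φ, ψ, hK_eq, hspan, U, V, hUV, hφ, hψ, by omega, by omega⟩

end Decomposition

section Calculus

variable {n : ℕ} {f g : Cn n → ℂ} {z : Cn n}

/-- The functional `ℓ ↦ (ℓ(∂/∂x^α) + s ℓ(∂/∂y^α)) / 2` on real differentials, which gives `∂/∂z^α`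
for `s = -i` and `∂/∂z̄^α` for `s = i`. -/
def wirtingerCLM (s : ℂ) (α : Fin n) : (Cn n →L[ℝ] ℂ) →L[ℝ] ℂ :=
  (2⁻¹ : ℂ) • (ContinuousLinearMap.apply ℝ ℂ (stdVec α) +
    s • ContinuousLinearMap.apply ℝ ℂ (Complex.I • stdVec α))

theorem wirtingerCLM_apply (s : ℂ) (α : Fin n) (ℓ : Cn n →L[ℝ] ℂ) :
    wirtingerCLM s α ℓ = 2⁻¹ * (ℓ (stdVec α) + s * ℓ (Complex.I • stdVec α)) := rfl

theorem wirt_eq_wirtingerCLM (α : Fin n) (f : Cn n → ℂ) :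
    wirt α f = fun w => wirtingerCLM (-Complex.I) α (fderiv ℝ f w) := by
  funext w
  rw [wirt, wirtingerCLM_apply]
  ring

theorem wirtBar_eq_wirtingerCLM (α : Fin n) (f : Cn n → ℂ) :
    wirtBar α f = fun w => wirtingerCLM Complex.I α (fderiv ℝ f w) := by
  funext w
  rw [wirtBar, wirtingerCLM_apply]
  ring

theorem wirtingerCLM_comp_comm (s t : ℂ) (α β : Fin n) {D : Cn n →L[ℝ] Cn n →L[ℝ] ℂ}
    (hD : ∀ v w, D v w = D w v) :
    wirtingerCLM t β (wirtingerCLM s α ∘L D) = wirtingerCLM s α (wirtingerCLM t β ∘L D) := by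
  simp only [wirtingerCLM_apply, ContinuousLinearMap.comp_apply, hD (stdVec α),
    hD (Complex.I • stdVec α) (Complex.I • stdVec β), hD (Complex.I • stdVec α) (stdVec β)]
  ring

theorem differentiableAt_fderiv (hf : ContDiffAt ℝ 2 f z) : DifferentiableAt ℝ (fderiv ℝ f) z :=
  (hf.fderiv_right (m := 1) (by norm_num)).differentiableAt one_ne_zero

theorem differentiableAt_wirt (hf : ContDiffAt ℝ 2 f z) (α : Fin n) :
    DifferentiableAt ℝ (wirt α f) z := by
  rw [wirt_eq_wirtingerCLM]
  exact (wirtingerCLM _ α).differentiableAt.comp z (differentiableAt_fderiv hf)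

theorem wirtBar_wirt_comm (hf : ContDiffAt ℝ 2 f z) (α β : Fin n) :
    wirtBar β (wirt α f) z = wirt α (wirtBar β f) z := by
  have fderiv_wirtingerCLM (s : ℂ) (γ : Fin n) :
      fderiv ℝ (fun w => wirtingerCLM s γ (fderiv ℝ f w)) z =
        wirtingerCLM s γ ∘L fderiv ℝ (fderiv ℝ f) z :=
    (wirtingerCLM s γ).hasFDerivAt.comp z (differentiableAt_fderiv hf).hasFDerivAt |>.fderiv
  simp only [wirtBar_eq_wirtingerCLM, wirt_eq_wirtingerCLM, fderiv_wirtingerCLM]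
  exact wirtingerCLM_comp_comm _ _ _ _ (hf.isSymmSndFDerivAt (by simp)).eq

theorem wirtBar_mul (hf : DifferentiableAt ℝ f z) (hg : DifferentiableAt ℝ g z) (β : Fin n) :
    wirtBar β (fun w => f w * g w) z = wirtBar β f z * g z + f z * wirtBar β g z := by
  simp only [wirtBar, fderiv_fun_mul hf hg, add_apply, smul_apply, smul_eq_mul]
  ring

theorem wirtBar_sum {κ : Type*} (s : Finset κ) {F : κ → Cn n → ℂ}
    (hF : ∀ k ∈ s, DifferentiableAt ℝ (F k) z) (β : Fin n) :
    wirtBar β (fun w => ∑ k ∈ s, F k w) z = ∑ k ∈ s, wirtBar β (F k) z := by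
  simp only [wirtBar_eq_wirtingerCLM, fderiv_fun_sum hF, map_sum]

theorem fderiv_conj (v : Cn n) : fderiv ℝ (fun w => conj (f w)) z v = conj (fderiv ℝ f z v) :=
  DFunLike.congr_fun (Complex.conjCLE.comp_fderiv (f := f) (x := z)) v

theorem conj_wirt (α : Fin n) : conj (wirt α f z) = wirtBar α (fun w => conj (f w)) z := by
  simp only [wirt, wirtBar, fderiv_conj, map_div₀, map_sub, map_mul, Complex.conj_I, map_ofNat]
  ring

theorem conj_wirtBar (α : Fin n) : conj (wirtBar α f z) = wirt α (fun w => conj (f w)) z := by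
  simp only [wirt, wirtBar, fderiv_conj, map_div₀, map_add, map_mul, Complex.conj_I, map_ofNat]
  ring

section Matrix

variable {ι : Type*} {M N : Cn n → Matrix ι ι ℂ}

/-- The entrywise derivative `∂M/∂z^α` of a matrix of functions. -/
def matrixWirt (α : Fin n) (M : Cn n → Matrix ι ι ℂ) (z : Cn n) : Matrix ι ι ℂ :=
  Matrix.of fun i k => wirt α (fun w => M w i k) z

/-- The entrywise derivative `∂M/∂z̄^β` of a matrix of functions. -/
def matrixWirtBar (β : Fin n) (M : Cn n → Matrix ι ι ℂ) (z : Cn n) : Matrix ι ι ℂ :=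
  Matrix.of fun i k => wirtBar β (fun w => M w i k) z

theorem conjTranspose_matrixWirt (α : Fin n) :
    (matrixWirt α M z).conjTranspose = matrixWirtBar α (fun w => (M w).conjTranspose) z := by
  ext i k
  exact conj_wirt α

theorem conjTranspose_matrixWirtBar (α : Fin n) :
    (matrixWirtBar α M z).conjTranspose = matrixWirt α (fun w => (M w).conjTranspose) z := by
  ext i k
  exact conj_wirtBar α

theorem matrixWirtBar_matrixWirt_comm (hM : ∀ i k, ContDiffAt ℝ 2 (fun w => M w i k) z)
    (α β : Fin n) :
    matrixWirtBar β (matrixWirt α M) z = matrixWirt α (matrixWirtBar β M) z := by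
  ext i k
  exact wirtBar_wirt_comm (hM i k) α β

theorem matrixWirtBar_congr (h : M =ᶠ[nhds z] N) (β : Fin n) :
    matrixWirtBar β M z = matrixWirtBar β N z := by
  ext i k
  have h_entry : (fun w => M w i k) =ᶠ[nhds z] fun w => N w i k :=
    h.fun_comp fun A : Matrix ι ι ℂ => A i k
  simp only [matrixWirtBar, Matrix.of_apply, wirtBar, h_entry.fderiv_eq]

variable [Fintype ι]

theorem matrixWirtBar_mul (hM : ∀ i k, DifferentiableAt ℝ (fun w => M w i k) z)
    (hN : ∀ i k, DifferentiableAt ℝ (fun w => N w i k) z) (β : Fin n) :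
    matrixWirtBar β (fun w => M w * N w) z =
      matrixWirtBar β M z * N z + M z * matrixWirtBar β N z := by
  ext i k
  simp only [matrixWirtBar, Matrix.of_apply, Matrix.add_apply, Matrix.mul_apply]
  rw [wirtBar_sum _ fun l _ => (hM i l).fun_mul (hN l k), ← Finset.sum_add_distrib]
  exact Finset.sum_congr rfl fun l _ => wirtBar_mul (hM i l) (hN l k) β

variable [DecidableEq ι]

theorem differentiableAt_det (hM : ∀ i j, DifferentiableAt ℝ (fun w => M w i j) z) :
    DifferentiableAt ℝ (fun w => (M w).det) z := by
  simp only [Matrix.det_apply']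
  exact DifferentiableAt.fun_sum fun σ _ =>
    (HasFDerivAt.finsetProd fun i _ => (hM _ _).hasFDerivAt).differentiableAt.const_mul _

theorem differentiableAt_matrix_inv (hM : ∀ i j, DifferentiableAt ℝ (fun w => M w i j) z)
    (hdet : (M z).det ≠ 0) (i j : ι) : DifferentiableAt ℝ (fun w => (M w)⁻¹ i j) z := by
  simp only [Matrix.inv_def, Matrix.smul_apply, Matrix.adjugate_apply, smul_eq_mul,
    Ring.inverse_eq_inv']
  refine ((differentiableAt_det hM).inv hdet).mul (differentiableAt_det fun k l => ?_)
  rcases eq_or_ne k j with rfl | h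
  · simp
  · simpa [Matrix.updateRow_ne h] using hM k l

end Matrix

variable {r : ℕ} {H : Cn n → Matrix (Fin r) (Fin r) ℂ}

theorem differentiableAt_connectionForm (hH : ∀ i k, ContDiffAt ℝ 2 (fun w => H w i k) z)
    (hdet : (H z).det ≠ 0) (α : Fin n) (j i : Fin r) :
    DifferentiableAt ℝ (fun w => connectionForm H α w j i) z := by
  have hH' := differentiableAt_matrix_inv
    (fun i k => (hH i k).differentiableAt two_ne_zero) hdet
  simp only [connectionForm, Matrix.transpose_apply, Matrix.mul_apply, Matrix.of_apply]
  exact DifferentiableAt.fun_sum fun l _ => (differentiableAt_wirt (hH i l) α).mul (hH' l j)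

theorem transpose_connectionForm_mul_eventuallyEq
    (hH : ∀ i k, DifferentiableAt ℝ (fun w => H w i k) z) (hdet : (H z).det ≠ 0) (α : Fin n) :
    (fun w => (connectionForm H α w).transpose * H w) =ᶠ[nhds z] matrixWirt α H := by
  filter_upwards [(differentiableAt_det hH).continuousAt.eventually_ne hdet] with w hw
  exact Matrix.nonsing_inv_mul_cancel_right (H w) (matrixWirt α H w) (isUnit_iff_ne_zero.mpr hw)

/-- Differentiate `θ_αᵀ h = ∂_α h`. -/
theorem transpose_curvatureMatrix_mul (hH : ∀ i k, ContDiffAt ℝ 2 (fun w => H w i k) z)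
    (hdet : (H z).det ≠ 0) (α β : Fin n) :
    (curvatureMatrix H α β z).transpose * H z =
      -matrixWirtBar β (matrixWirt α H) z +
        matrixWirt α H z * (H z)⁻¹ * matrixWirtBar β H z := by
  have hH' (i k) : DifferentiableAt ℝ (fun w => H w i k) z :=
    (hH i k).differentiableAt two_ne_zero
  have curvature_eq : (curvatureMatrix H α β z).transpose =
      -matrixWirtBar β (fun w => (connectionForm H α w).transpose) z := rfl
  have connection_eq : (connectionForm H α z).transpose = matrixWirt α H z * (H z)⁻¹ := rfl
  rw [curvature_eq, ← connection_eq,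
    ← matrixWirtBar_congr (transpose_connectionForm_mul_eventuallyEq hH' hdet α) β,
    matrixWirtBar_mul (M := fun w => (connectionForm H α w).transpose)
      (fun i k => differentiableAt_connectionForm hH hdet α k i) hH']
  noncomm_ring

theorem conjTranspose_transpose_curvatureMatrix_mul
    (hH : ∀ i k, ContDiffAt ℝ 2 (fun w => H w i k) z) (hH_herm : ∀ w, (H w).IsHermitian)
    (hdet : (H z).det ≠ 0) (α β : Fin n) :
    ((curvatureMatrix H α β z).transpose * H z).conjTranspose =
      (curvatureMatrix H β α z).transpose * H z := by
  have conj_wirt_H (γ : Fin n) (w : Cn n) :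
      (matrixWirt γ H w).conjTranspose = matrixWirtBar γ H w := by
    rw [conjTranspose_matrixWirt, funext hH_herm]
  have conj_wirtBar_H (γ : Fin n) :
      (matrixWirtBar γ H z).conjTranspose = matrixWirt γ H z := by
    rw [← conj_wirt_H, Matrix.conjTranspose_conjTranspose]
  rw [transpose_curvatureMatrix_mul hH hdet, transpose_curvatureMatrix_mul hH hdet,
    Matrix.conjTranspose_add, Matrix.conjTranspose_neg, conjTranspose_matrixWirtBar,
    funext (conj_wirt_H α), matrixWirtBar_matrixWirt_comm hH, Matrix.conjTranspose_mul,
    Matrix.conjTranspose_mul, Matrix.conjTranspose_nonsing_inv, conj_wirt_H, conj_wirtBar_H,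
    hH_herm z, Matrix.mul_assoc]

end Calculus

section Curvature

variable {n r : ℕ} {X : Type*} [TopologicalSpace X] [ChartedSpace (Cn n) X]

instance (x : X) : FiniteDimensional ℂ (HolTangent n x) :=
  inferInstanceAs (FiniteDimensional ℂ (Cn n))

/-- The coordinate basis `∂_1, …, ∂_n` of the holomorphic tangent space. -/
def tangentBasis (x : X) : Module.Basis (Fin n) ℂ (HolTangent n x) :=
  (EuclideanSpace.basisFun (Fin n) ℂ).toBasis

theorem tangentBasis_apply (x : X) (α : Fin n) : tangentBasis x α = tangentVec x α := by
  change (EuclideanSpace.basisFun (Fin n) ℂ).toBasis α = stdVec α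
  simp [stdVec]

theorem dz_eq_coord (x : X) (α : Fin n) : dz x α = (tangentBasis x).coord α := rfl

/-- The isomorphism `(u^{i α}) ↦ (u^{i α} ∂_α)_i`. -/
def tensorEquiv (ι : Type*) (x : X) : (ι → Fin n → ℂ) ≃ₗ[ℂ] (ι → HolTangent n x) :=
  LinearEquiv.piCongrRight fun _ => (tangentBasis x).equivFun.symm

theorem dz_tensorEquiv {ι : Type*} (x : X) (u : ι → Fin n → ℂ) (i : ι) (α : Fin n) :
    dz x α (tensorEquiv ι x u i) = u i α := by
  simp [dz_eq_coord, tensorEquiv, Module.Basis.equivFun_symm_apply,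
    Finsupp.single_apply]

theorem isTensorIn_iff {x : X} {U : Submodule ℂ (HolTangent n x)} {u : Fin r → Fin n → ℂ} :
    IsTensorIn U u ↔ ∀ i, tensorEquiv (Fin r) x u i ∈ U := by
  simp [IsTensorIn, tensorEquiv, Module.Basis.equivFun_symm_apply, tangentBasis_apply]

theorem rank_boldA {x : X} {N : ℕ} (A : Matrix (Fin r) (Fin N) (HolTangent n x →ₗ[ℂ] ℂ)) :
    (boldA A).rank = finrank ℂ (LinearMap.range (contract A)) := by
  simp only [← rank_of_apply_basis (tangentBasis x), tangentBasis_apply, boldA]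

theorem rank_boldB {x : X} {N : ℕ} (B : Matrix (Fin r) (Fin N) (HolTangent n x →ₗ⋆[ℂ] ℂ)) :
    (boldB B).rank = finrank ℂ (LinearMap.range (contract (B.map conj01))) := by
  rw [← rank_of_apply_basis (tangentBasis x), ← Matrix.rank_transpose, ← Matrix.rank_conjTranspose]
  congr 1
  ext p q
  simp [boldB, tangentBasis_apply, conj01]

theorem map_conj01_surjective (x : X) (ι κ : Type*) :
    Function.Surjective fun B : Matrix ι κ (HolTangent n x →ₗ⋆[ℂ] ℂ) => B.map conj01 :=
  fun φ => ⟨φ.map conj10, by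
    ext i p v
    simp [conj01, conj10]⟩

theorem vanishesOn_map_conj01_iff {x : X} {ι κ : Type*}
    {B : Matrix ι κ (HolTangent n x →ₗ⋆[ℂ] ℂ)} {V : Submodule ℂ (HolTangent n x)} :
    VanishesOn (B.map conj01) V ↔ ∀ i p, ∀ v ∈ V, B i p v = 0 := by
  simp [VanishesOn, conj01]

variable {E : X → Type*} [TopologicalSpace (TotalSpace (Cn r) E)]
  [∀ x, AddCommGroup (E x)] [∀ x, Module ℂ (E x)] [∀ x, TopologicalSpace (E x)]
  [FiberBundle (Cn r) E] [VectorBundle ℂ (Cn r) E]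

theorem metricMatrix_chartAt (h : HermitianMetric n r E) (x : X) :
    metricMatrix h x (chartAt (Cn n) x x) =
      Matrix.of fun i k => h.form x (frameBasis (r := r) E x i) (frameBasis E x k) := by
  have eq_of_eq (y : X) (hy : y = x) (i k : Fin r) :
      h.form y (localFrame E x i y) (localFrame E x k y) =
        h.form x (frameBasis E x i) (frameBasis E x k) := by
    subst hy
    simp only [frameBasis_apply]
  ext i k
  exact eq_of_eq _ ((chartAt (Cn n) x).left_inv (mem_chart_source _ x)) i k

theorem contDiffAt_metricMatrix (h : HermitianMetric n r E) (x : X) (i k : Fin r) :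
    ContDiffAt ℝ ∞ (fun z => metricMatrix h x z i k) (chartAt (Cn n) x x) := by
  have h_smooth := (h.smooth (trivializationAt (Cn r) E x) (stdVec i) (stdVec k)).contMDiffAt
    ((trivializationAt (Cn r) E x).open_baseSet.mem_nhds
      (FiberBundle.mem_baseSet_trivializationAt (Cn r) E x))
  have h_chart := (contMDiffAt_iff.mp h_smooth).2
  simp only [mfld_simps] at h_chart
  exact contDiffWithinAt_univ.mp h_chart

theorem isHermitian_metricMatrix (h : HermitianMetric n r E) (x : X) (z : Cn n) :
    (metricMatrix h x z).IsHermitian := by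
  ext i k
  exact h.conj_symm _ _ _

theorem curvatureCoeff_eq (h : HermitianMetric n r E) (x : X) (i j : Fin r) (α β : Fin n) :
    curvatureCoeff h x i j α β =
      ((curvatureMatrix (metricMatrix h x) α β (chartAt (Cn n) x x)).transpose *
        metricMatrix h x (chartAt (Cn n) x x)) i j := by
  simp [curvatureCoeff, curvatureEnd, Matrix.toLin_self, metricMatrix_chartAt, Matrix.mul_apply]

theorem conj_curvatureCoeff (h : HermitianMetric n r E) (x : X) (i j : Fin r) (α β : Fin n) :
    conj (curvatureCoeff h x i j α β) = curvatureCoeff h x j i β α := by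
  have hdet : (metricMatrix h x (chartAt (Cn n) x x)).det ≠ 0 := by
    rw [metricMatrix_chartAt]
    exact det_ne_zero_of_pos (frameBasis E x) (h.pos x)
  rw [curvatureCoeff_eq, curvatureCoeff_eq]
  exact congrFun₂ (conjTranspose_transpose_curvatureMatrix_mul
    (fun i k => (contDiffAt_metricMatrix h x i k).of_le (WithTop.coe_le_coe.mpr le_top))
    (isHermitian_metricMatrix h x) hdet α β) j i

theorem conj_form_curvatureEnd (h : HermitianMetric n r E) (x : X) (α β : Fin n) (s t : E x) :
    conj (h.form x (curvatureEnd h x α β s) t) = h.form x (curvatureEnd h x β α t) s := by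
  have conj_coeff := conj_curvatureCoeff h x
  simp only [curvatureCoeff] at conj_coeff
  rw [← (frameBasis (r := r) E x).sum_repr s, ← (frameBasis (r := r) E x).sum_repr t]
  simp only [map_sum, map_smul, LinearMap.sum_apply, LinearMap.smul_apply,
    LinearMap.map_smulₛₗ, smul_eq_mul, map_mul, Complex.conj_conj, conj_coeff, Finset.mul_sum]
  rw [Finset.sum_comm]
  exact Finset.sum_congr rfl fun i _ => Finset.sum_congr rfl fun j _ => by ring

/-- The covariant curvature `(s, t) ↦ h(R_{α β̄} s, t) dz^α ⊗ dz̄^β`. -/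
def curvatureTensor (h : HermitianMetric n r E) (x : X) :
    E x →ₗ[ℂ] E x →ₗ⋆[ℂ] SesqForm ℂ (HolTangent n x) :=
  LinearMap.mk₂'ₛₗ (RingHom.id ℂ) (starRingEnd ℂ)
    (fun s t => ∑ α, ∑ β, h.form x (curvatureEnd h x α β s) t • tensorConj (dz x α) (dz x β))
    (fun _ _ _ => by simp [add_smul, Finset.sum_add_distrib])
    (fun _ _ _ => by simp [Finset.smul_sum, mul_smul])
    (fun _ _ _ => by simp [add_smul, Finset.sum_add_distrib])
    (fun _ _ _ => by simp [Finset.smul_sum, mul_smul])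

theorem curvatureTensor_apply (h : HermitianMetric n r E) (x : X) (s t : E x)
    (v w : HolTangent n x) :
    curvatureTensor h x s t v w =
      ∑ α, ∑ β, h.form x (curvatureEnd h x α β s) t * (dz x α v * conj (dz x β w)) := by
  simp [curvatureTensor]

theorem isHermitianArray_frameMatrix_curvatureTensor {ι : Type*} (h : HermitianMetric n r E)
    {x : X} (e : ι → E x) : IsHermitianArray (frameMatrix (curvatureTensor h x) e) := by
  intro i j v w
  simp only [frameMatrix, Matrix.of_apply, curvatureTensor_apply, map_sum, map_mul,
    Complex.conj_conj, conj_form_curvatureEnd]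
  rw [Finset.sum_comm]
  exact Finset.sum_congr rfl fun _ _ => Finset.sum_congr rfl fun _ _ => by ring

/-- The matrix of forms `R_{i j̄} = R_{i j̄ α β̄} dz^α ⊗ dz̄^β` in the holomorphic frame at `x`. -/
def curvatureArray (h : HermitianMetric n r E) (x : X) :
    Matrix (Fin r) (Fin r) (SesqForm ℂ (HolTangent n x)) :=
  frameMatrix (curvatureTensor h x) (frameBasis E x)

theorem nakanoForm_eq_blockForm (h : HermitianMetric n r E) (x : X) (u v : Fin r → Fin n → ℂ) :
    nakanoForm h x u v =
      blockForm (curvatureArray h x) (tensorEquiv _ x u) (tensorEquiv _ x v) := by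
  simp only [nakanoForm, curvatureCoeff, blockForm_apply, curvatureArray, frameMatrix,
    Matrix.of_apply, curvatureTensor_apply, dz_tensorEquiv, mul_assoc]

theorem dualNakanoForm_eq_blockForm (h : HermitianMetric n r E) (x : X)
    (v : Fin r → Fin n → ℂ) :
    dualNakanoForm h x v =
      blockForm (curvatureArray h x).transpose
        (tensorEquiv _ x v) (tensorEquiv _ x v) := by
  simp only [dualNakanoForm, curvatureCoeff, blockForm_apply, curvatureArray,
    Matrix.transpose_apply, frameMatrix, Matrix.of_apply, curvatureTensor_apply, dz_tensorEquiv,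
    mul_assoc]
  exact Finset.sum_comm

theorem isTypeIDecomposition_curvatureArray_iff {P : ℂ → Prop} {h : HermitianMetric n r E} {x : X}
    {U V : Submodule ℂ (HolTangent n x)} :
    IsTypeIDecomposition P (curvatureArray h x) U V ↔
      IsCompl U V ∧
      (∀ u, IsTensorIn (r := r) U u → u ≠ 0 → P (nakanoForm h x u u)) ∧
      (∀ u v, IsTensorIn (r := r) U u → IsTensorIn (r := r) V v → nakanoForm h x u v = 0) ∧
      (∀ v, IsTensorIn (r := r) V v → v ≠ 0 → P (dualNakanoForm h x v)) := by
  have forall_tensor {Q : (Fin r → HolTangent n x) → Prop} :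
      (∀ u, Q u) ↔ ∀ u, Q (tensorEquiv (Fin r) x u) := (tensorEquiv (Fin r) x).surjective.forall
  have tensor_ne_zero (u : Fin r → Fin n → ℂ) : tensorEquiv (Fin r) x u ≠ 0 ↔ u ≠ 0 :=
    (tensorEquiv (Fin r) x).map_ne_zero_iff
  constructor
  · rintro ⟨hUV, hU, hcross, hV⟩
    simp only [forall_tensor, tensor_ne_zero] at hU hcross hV
    simpa only [isTensorIn_iff, nakanoForm_eq_blockForm, dualNakanoForm_eq_blockForm]
      using ⟨hUV, hU, hcross, hV⟩
  · rintro ⟨hUV, hU, hcross, hV⟩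
    simp only [isTensorIn_iff, nakanoForm_eq_blockForm, dualNakanoForm_eq_blockForm] at hU hcross hV
    refine ⟨hUV, ?_, ?_, ?_⟩ <;> simpa only [forall_tensor, tensor_ne_zero]

theorem isStronglyDecomposablyNonnegI_iff (h : HermitianMetric n r E) :
    IsStronglyDecomposablyNonnegI h ↔ ∀ x, ∃ U V : Submodule ℂ (HolTangent n x),
      IsTypeIDecomposition (0 ≤ ·) (curvatureArray h x) U V :=
  forall_congr' fun _ => exists₂_congr fun _ _ => isTypeIDecomposition_curvatureArray_iff.symm

theorem isStronglyDecomposablyPosI_iff (h : HermitianMetric n r E) :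
    IsStronglyDecomposablyPosI h ↔ ∀ x, ∃ U V : Submodule ℂ (HolTangent n x),
      IsTypeIDecomposition (0 < ·) (curvatureArray h x) U V :=
  forall_congr' fun _ => exists₂_congr fun _ _ => isTypeIDecomposition_curvatureArray_iff.symm

section UnitaryFrame

variable {h : HermitianMetric n r E} {x : X} {e : Module.Basis (Fin r) ℂ (E x)}

theorem IsUnitaryFrame.repr_apply (he : IsUnitaryFrame h e) (s : E x) (j : Fin r) :
    e.repr s j = h.form x s (e j) := by
  conv_rhs => rw [← e.sum_repr s]
  simp only [map_sum, map_smul, LinearMap.sum_apply, LinearMap.smul_apply, smul_eq_mul, he _ _,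
    mul_ite, mul_one, mul_zero, Finset.sum_ite_eq', Finset.mem_univ, if_true]

theorem IsUnitaryFrame.toMatrix_chernCurvature (he : IsUnitaryFrame h e) (v w : HolTangent n x)
    (j i : Fin r) :
    LinearMap.toMatrix e e (chernCurvature h x v w) j i =
      frameMatrix (curvatureTensor h x) e i j v w -
        frameMatrix (curvatureTensor h x) e i j w v := by
  rw [LinearMap.toMatrix_apply, he.repr_apply, chernCurvature]
  simp only [frameMatrix, Matrix.of_apply, curvatureTensor_apply, LinearMap.sum_apply,
    LinearMap.smul_apply, map_sum, map_smul, smul_eq_mul, ← Finset.sum_sub_distrib, ← mul_sub]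
  exact Finset.sum_congr rfl fun _ _ => Finset.sum_congr rfl fun _ _ => mul_comm _ _

theorem sum_wedge_eq_sub_swap {ι κ κ' : Type*} [Fintype κ] [Fintype κ']
    (B : Matrix ι κ (HolTangent n x →ₗ⋆[ℂ] ℂ)) (A : Matrix ι κ' (HolTangent n x →ₗ[ℂ] ℂ))
    (v w : HolTangent n x) (j i : ι) :
    -(∑ p, wedge (B j p) (conj01 (B i p)) v w) + ∑ p, wedge (A j p) (conj10 (A i p)) v w =
      (gram (B.map conj01) + (gram A).transpose) i j v w -
        (gram (B.map conj01) + (gram A).transpose) i j w v := by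
  simp only [wedge, conj01, conj10, Matrix.add_apply, Matrix.transpose_apply, LinearMap.add_apply,
    gram_apply, Matrix.map_apply, LinearMap.coe_mk, AddHom.coe_mk, Complex.conj_conj,
    Finset.sum_sub_distrib, mul_comm (starRingEnd ℂ (B i _ _))]
  ring

theorem IsUnitaryFrame.curvatureFactors_iff (he : IsUnitaryFrame h e) {N₁ N₂ : ℕ}
    {B : Matrix (Fin r) (Fin N₂) (HolTangent n x →ₗ⋆[ℂ] ℂ)}
    {A : Matrix (Fin r) (Fin N₁) (HolTangent n x →ₗ[ℂ] ℂ)} :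
    CurvatureFactors h e B A ↔
      frameMatrix (curvatureTensor h x) e = gram (B.map conj01) + (gram A).transpose := by
  simp only [CurvatureFactors, he.toMatrix_chernCurvature, sum_wedge_eq_sub_swap, ← Matrix.ext_iff,
    ← sub_swap_eq_sub_swap_iff]
  exact ⟨fun H i j v w => H v w j i, fun H v w j i => H i j v w⟩

theorem exists_isTypeIDecomposition_curvatureArray_iff {P : ℂ → Prop}
    (e : Module.Basis (Fin r) ℂ (E x)) :
    (∃ U V, IsTypeIDecomposition P (curvatureArray h x) U V) ↔
      ∃ U V, IsTypeIDecomposition P (frameMatrix (curvatureTensor h x) e) U V :=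
  exists₂_congr fun _ _ => ⟨fun H => H.of_frameMatrix e, fun H => H.of_frameMatrix _⟩

theorem IsUnitaryFrame.exists_isTypeIDecomposition_nonneg_iff (he : IsUnitaryFrame h e) :
    (∃ U V, IsTypeIDecomposition (0 ≤ ·) (curvatureArray h x) U V) ↔
      ∃ (N₁ N₂ : ℕ) (B : Matrix (Fin r) (Fin N₂) (HolTangent n x →ₗ⋆[ℂ] ℂ))
        (A : Matrix (Fin r) (Fin N₁) (HolTangent n x →ₗ[ℂ] ℂ)),
        CurvatureFactors h e B A ∧ spanBBar B ⊓ spanA A = ⊥ := by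
  rw [exists_isTypeIDecomposition_curvatureArray_iff e,
    (isHermitianArray_frameMatrix_curvatureTensor h e).exists_isTypeIDecomposition_nonneg_iff]
  refine exists₂_congr fun N₁ N₂ => (map_conj01_surjective x _ _).exists.trans ?_
  simp only [he.curvatureFactors_iff]
  rfl

theorem IsUnitaryFrame.exists_isTypeIDecomposition_pos_iff (he : IsUnitaryFrame h e) :
    (∃ U V, IsTypeIDecomposition (0 < ·) (curvatureArray h x) U V) ↔
      ∃ (N₁ N₂ : ℕ) (B : Matrix (Fin r) (Fin N₂) (HolTangent n x →ₗ⋆[ℂ] ℂ))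
        (A : Matrix (Fin r) (Fin N₁) (HolTangent n x →ₗ[ℂ] ℂ)),
        CurvatureFactors h e B A ∧ spanBBar B ⊓ spanA A = ⊥ ∧
        ∃ U V : Submodule ℂ (HolTangent n x), IsCompl U V ∧
          (boldA A).rank = r * finrank ℂ V ∧ (boldB B).rank = r * finrank ℂ U := by
  rw [exists_isTypeIDecomposition_curvatureArray_iff e,
    (isHermitianArray_frameMatrix_curvatureTensor h e).exists_isTypeIDecomposition_pos_iff]
  refine exists₂_congr fun N₁ N₂ => (map_conj01_surjective x _ _).exists.trans ?_
  simp only [he.curvatureFactors_iff, rank_boldA, rank_boldB, Fintype.card_fin]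
  rfl

theorem IsUnitaryFrame.exists_isTypeIDecomposition_pos_iff_vanish (he : IsUnitaryFrame h e) :
    (∃ U V, IsTypeIDecomposition (0 < ·) (curvatureArray h x) U V) ↔
      ∃ (N₁ N₂ : ℕ) (B : Matrix (Fin r) (Fin N₂) (HolTangent n x →ₗ⋆[ℂ] ℂ))
        (A : Matrix (Fin r) (Fin N₁) (HolTangent n x →ₗ[ℂ] ℂ)),
        CurvatureFactors h e B A ∧ spanBBar B ⊓ spanA A = ⊥ ∧
        ∃ U V : Submodule ℂ (HolTangent n x), IsCompl U V ∧
          (∀ i p, ∀ v ∈ V, B i p v = 0) ∧ (∀ i p, ∀ u ∈ U, A i p u = 0) ∧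
          (boldA A).rank = r * finrank ℂ V ∧ (boldB B).rank = r * finrank ℂ U := by
  have hK := isHermitianArray_frameMatrix_curvatureTensor h e
  rw [exists_isTypeIDecomposition_curvatureArray_iff e,
    hK.exists_isTypeIDecomposition_pos_iff_vanishesOn]
  refine exists₂_congr fun N₁ N₂ => (map_conj01_surjective x _ _).exists.trans ?_
  simp only [he.curvatureFactors_iff, rank_boldA, rank_boldB, Fintype.card_fin,
    vanishesOn_map_conj01_iff]
  rfl

theorem exists_isUnitaryFrame (h : HermitianMetric n r E) (x : X) :
    ∃ e : Module.Basis (Fin r) ℂ (E x), IsUnitaryFrame h e := by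
  have : FiniteDimensional ℂ (E x) := (frameBasis (r := r) E x).finiteDimensional_of_finite
  exact exists_basis_unitary (Module.finrank_eq_card_basis (frameBasis (r := r) E x)) (h.form x)
    (h.conj_symm x) (h.pos x)

theorem iff_exists_isUnitaryFrame {L : Prop} {Q : Module.Basis (Fin r) ℂ (E x) → Prop}
    (H : ∀ e, IsUnitaryFrame h e → (L ↔ Q e)) : L ↔ ∃ e, IsUnitaryFrame h e ∧ Q e := by
  obtain ⟨e, he⟩ := exists_isUnitaryFrame h x
  exact ⟨fun hL => ⟨e, he, (H e he).mp hL⟩, fun ⟨e', he', hQ⟩ => (H e' he').mpr hQ⟩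

theorem iff_forall_isUnitaryFrame {L : Prop} {Q : Module.Basis (Fin r) ℂ (E x) → Prop}
    (H : ∀ e, IsUnitaryFrame h e → (L ↔ Q e)) : L ↔ ∀ e, IsUnitaryFrame h e → Q e := by
  obtain ⟨e, he⟩ := exists_isUnitaryFrame h x
  exact ⟨fun hL e' he' => (H e' he').mp hL, fun hQ => (H e he).mpr (hQ e he)⟩

end UnitaryFrame

end Curvature

end ChernCriterion

end

theorem theorem4p1 {n r : ℕ} {X : Type*} [TopologicalSpace X] [ChartedSpace (ChernCriterion.Cn n) X]
    [IsManifold 𝓘(ℂ, ChernCriterion.Cn n) ω X]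
    {E : X → Type*} [TopologicalSpace (TotalSpace (ChernCriterion.Cn r) E)]
    [∀ x, AddCommGroup (E x)] [∀ x, Module ℂ (E x)] [∀ x, TopologicalSpace (E x)]
    [FiberBundle (ChernCriterion.Cn r) E] [VectorBundle ℂ (ChernCriterion.Cn r) E]
    [ContMDiffVectorBundle ω (ChernCriterion.Cn r) E 𝓘(ℂ, ChernCriterion.Cn n)]
    (h : ChernCriterion.HermitianMetric n r E) :
    -- non-negativity: the criterion in one unitary frame, and in every unitary frame
    (ChernCriterion.IsStronglyDecomposablyNonnegI h ↔
      ∀ x : X, ∃ e : Module.Basis (Fin r) ℂ (E x), ChernCriterion.IsUnitaryFrame h e ∧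
        ∃ (N₁ N₂ : ℕ)
          (B : Matrix (Fin r) (Fin N₂) (ChernCriterion.HolTangent n x →ₗ⋆[ℂ] ℂ))
          (A : Matrix (Fin r) (Fin N₁) (ChernCriterion.HolTangent n x →ₗ[ℂ] ℂ)),
          ChernCriterion.CurvatureFactors h e B A ∧
          ChernCriterion.spanBBar B ⊓ ChernCriterion.spanA A = ⊥) ∧
    (ChernCriterion.IsStronglyDecomposablyNonnegI h ↔
      ∀ x : X, ∀ e : Module.Basis (Fin r) ℂ (E x), ChernCriterion.IsUnitaryFrame h e →
        ∃ (N₁ N₂ : ℕ)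
          (B : Matrix (Fin r) (Fin N₂) (ChernCriterion.HolTangent n x →ₗ⋆[ℂ] ℂ))
          (A : Matrix (Fin r) (Fin N₁) (ChernCriterion.HolTangent n x →ₗ[ℂ] ℂ)),
          ChernCriterion.CurvatureFactors h e B A ∧
          ChernCriterion.spanBBar B ⊓ ChernCriterion.spanA A = ⊥) ∧
    -- positivity: in one unitary frame, with only the dimensions of `U` and `V` prescribed
    (ChernCriterion.IsStronglyDecomposablyPosI h ↔
      ∀ x : X, ∃ e : Module.Basis (Fin r) ℂ (E x), ChernCriterion.IsUnitaryFrame h e ∧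
        ∃ (N₁ N₂ : ℕ)
          (B : Matrix (Fin r) (Fin N₂) (ChernCriterion.HolTangent n x →ₗ⋆[ℂ] ℂ))
          (A : Matrix (Fin r) (Fin N₁) (ChernCriterion.HolTangent n x →ₗ[ℂ] ℂ)),
          ChernCriterion.CurvatureFactors h e B A ∧
          ChernCriterion.spanBBar B ⊓ ChernCriterion.spanA A = ⊥ ∧
          ∃ U V : Submodule ℂ (ChernCriterion.HolTangent n x), IsCompl U V ∧
            (ChernCriterion.boldA A).rank = r * Module.finrank ℂ V ∧
            (ChernCriterion.boldB B).rank = r * Module.finrank ℂ U) ∧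
    -- positivity: in every unitary frame, with entries of `B̄` in `U*` and entries of `A` in `V*`
    (ChernCriterion.IsStronglyDecomposablyPosI h ↔
      ∀ x : X, ∀ e : Module.Basis (Fin r) ℂ (E x), ChernCriterion.IsUnitaryFrame h e →
        ∃ (N₁ N₂ : ℕ)
          (B : Matrix (Fin r) (Fin N₂) (ChernCriterion.HolTangent n x →ₗ⋆[ℂ] ℂ))
          (A : Matrix (Fin r) (Fin N₁) (ChernCriterion.HolTangent n x →ₗ[ℂ] ℂ)),
          ChernCriterion.CurvatureFactors h e B A ∧
          ChernCriterion.spanBBar B ⊓ ChernCriterion.spanA A = ⊥ ∧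
          ∃ U V : Submodule ℂ (ChernCriterion.HolTangent n x), IsCompl U V ∧
            (∀ i p, ∀ v ∈ V, B i p v = 0) ∧ (∀ i p, ∀ u ∈ U, A i p u = 0) ∧
            (ChernCriterion.boldA A).rank = r * Module.finrank ℂ V ∧
            (ChernCriterion.boldB B).rank = r * Module.finrank ℂ U) := by
  rw [ChernCriterion.isStronglyDecomposablyNonnegI_iff,
    ChernCriterion.isStronglyDecomposablyPosI_iff]
  exact
    ⟨forall_congr' fun _ => ChernCriterion.iff_exists_isUnitaryFrame fun _ he =>
        he.exists_isTypeIDecomposition_nonneg_iff,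
      forall_congr' fun _ => ChernCriterion.iff_forall_isUnitaryFrame fun _ he =>
        he.exists_isTypeIDecomposition_nonneg_iff,
      forall_congr' fun _ => ChernCriterion.iff_exists_isUnitaryFrame fun _ he =>
        he.exists_isTypeIDecomposition_pos_iff,
      forall_congr' fun _ => ChernCriterion.iff_forall_isUnitaryFrame fun _ he =>
        he.exists_isTypeIDecomposition_pos_iff_vanish⟩
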